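/- Let $\rho>0$, let $a:[0,1]\to\mathbb{R}$ be continuous, let $q_0,q_1\in\mathbb{R}$, and consider on the complex Hilbert space $X=L_2(0,1)$ the operator $\mathcal{A}h=\rho h''+ah$ with domain $D(\mathcal{A})=\{h\in H^2(0,1)\mid h'(0)=q_0h(0),\ h'(1)=q_1h(1)\}$. Let $\lambda_1>\lambda_2>\dots$ be its (real, simple) eigenvalues in decreasing order, and let $\phi_i$, $i\in\mathbb{N}$, be corresponding real-valued eigenvectors with $\|\phi_i\|_{L_2}=1$. For $n\ge 0$ put $\Lambda_n=\operatorname{diag}(\lambda_1,\dots,\lambda_n)$, $b_i=\rho\,(-\phi_i(0),\phi_i(1))^{T}\in\mathbb{R}^2$, let $B_n$ be the $n\times 2$ matrix with rows $b_1^{T},\dots,b_n^{T}$, and let $\Lambda_\infty=\operatorname{diag}(\lambda_{n+1},\lambda_{n+2},\dots)$, an operator on $\ell_2$ with spectrum $\sigma(\Lambda_\infty)=\{\lambda_{n+1},\lambda_{n+2},\dots\}$. Let a feedback gain $K\in\mathbb{C}^{2\times n}$ assign the closed-loop eigenvalues $\tilde\lambda_1,\dots,\tilde\lambda_n\in\mathbb{C}$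 with parameter vectors $p_1,\dots,p_n\in\mathbb{C}^2$, i.e., there are nonzero vectors $\tilde v_1,\dots,\tilde v_n\in\mathbb{C}^n$ with $(\Lambda_n-\tilde\lambda_iI)\tilde v_i=B_np_i$ and $p_i=K\tilde v_i$ for $i=1,\dots,n$, so that $(\Lambda_n-B_nK)\tilde v_i=\tilde\lambda_i\tilde v_i$. (For example, $\tilde\lambda_i\notin\{\lambda_1,\dots,\lambda_n\}$, $\tilde v_i=(\Lambda_n-\tilde\lambda_iI)^{-1}B_np_i$ linearly independent, and $K=[p_1\,\cdots\,p_n][\tilde v_1\,\cdots\,\tilde v_n]^{-1}$.) Put $P=[p_1\,\cdots\,p_n]$, $\tilde V=[\tilde v_1\,\cdots\,\tilde v_n]$, $\tilde\Lambda_n=\operatorname{diag}(\tilde\lambda_1,\dots,\tilde\lambda_n)$. Suppose that $\tilde\lambda_1,\dots,\tilde\lambda_n$ are distinct and not contained in $\sigma(\Lambda_\infty)$. (Then $\tilde V$ and $\tilde\Lambda_n-\lambda_iI$, $i>n$, are invertible.) Define $c_i\in\mathbb{C}^n$ by $\overline{c_i}^{T}=e_i^{T}\tilde V^{-1}$ for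 $i\le n$ and $\overline{c_i}^{T}=b_i^{T}P(\tilde\Lambda_n-\lambda_iI)^{-1}\tilde V^{-1}$ for $i>n$, where $e_i$ is the $i$-th unit vector, and let $$\tilde\psi_i=\begin{cases}\sum_{j=1}^n c_{i,j}\phi_j, & i\le n,\\[2pt] \phi_i+\sum_{j=1}^n c_{i,j}\phi_j, & i>n.\end{cases}$$ Then $\{\tilde\psi_i\}_{i\in\mathbb{N}}$ is a Riesz basis of $X$: its linear span is dense in $X$, and there are constants $m,M>0$ such that $m\sum_i|\alpha_i|^2\le\|\sum_i\alpha_i\tilde\psi_i\|_{L_2}^2\le M\sum_i|\alpha_i|^2$ for all finitely supported complex sequences $(\alpha_i)$. -/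

import Mathlib

open MeasureTheory

noncomputable section

/-- Lebesgue measure on the interval `(0,1)`. -/
abbrev unitVol : Measure ℝ := volume.restrict (Set.Ioo (0 : ℝ) 1)

/-- The complex Hilbert space `L₂(0,1)`. -/
abbrev StateSpace : Type := Lp ℂ 2 unitVol

/-- `h ∈ H²(0,1)`, where `h` is the continuously differentiable representative on `[0,1]`, `h₁` is
its derivative (so that `h 0`, `h 1`, `h₁ 0`, `h₁ 1` are the boundary values) and `h₂` is the
second derivative: `h`, `h₁` are absolutely continuous on `[0,1]`, being primitives of `h₁`, `h₂`,
and `h, h₁, h₂ ∈ L₂(0,1)`. -/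
structure IsSobolevH2 (h h₁ h₂ : ℝ → ℂ) : Prop where
  memLp : MemLp h 2 unitVol
  memLp_one : MemLp h₁ 2 unitVol
  memLp_two : MemLp h₂ 2 unitVol
  primitive_one : ∀ z ∈ Set.Icc (0 : ℝ) 1, h z = h 0 + ∫ t in (0 : ℝ)..z, h₁ t
  primitive_two : ∀ z ∈ Set.Icc (0 : ℝ) 1, h₁ z = h₁ 0 + ∫ t in (0 : ℝ)..z, h₂ t

/-- The graph of the operator `𝒜 h = ρ h'' + a h` with domain
`{h ∈ H²(0,1) | h'(0) = q₀ h(0), h'(1) = q₁ h(1)}`: `h` is in the domain and `𝒜 h = g`. -/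
def SLGraph (ρ : ℝ) (a : ℝ → ℝ) (q₀ q₁ : ℝ) (h g : ℝ → ℂ) : Prop :=
  ∃ h₁ h₂ : ℝ → ℂ, IsSobolevH2 h h₁ h₂ ∧
    h₁ 0 = q₀ * h 0 ∧ h₁ 1 = q₁ * h 1 ∧
    ∀ᵐ z ∂unitVol, g z = ρ * h₂ z + a z * h z

/-- `h` is an eigenvector of `𝒜` for the eigenvalue `μ`. -/
def IsEigenpair (ρ : ℝ) (a : ℝ → ℝ) (q₀ q₁ : ℝ) (μ : ℂ) (h : ℝ → ℂ) : Prop :=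
  SLGraph ρ a q₀ q₁ h (fun z => μ * h z) ∧ ¬ ∀ᵐ z ∂unitVol, h z = 0

/-- `lam 0 > lam 1 > ...` are the real eigenvalues of `𝒜` (it has no others, as it is
self-adjoint), and `φ i` is a real-valued eigenvector for `lam i` of norm one in `L₂(0,1)`. -/
structure IsEigensystem (ρ : ℝ) (a : ℝ → ℝ) (q₀ q₁ : ℝ) (lam : ℕ → ℝ) (φ : ℕ → ℝ → ℝ) :
    Prop where
  strictAnti : StrictAnti lam
  exhaustive : ∀ μ : ℝ, (∃ h, IsEigenpair ρ a q₀ q₁ (μ : ℂ) h) → ∃ i, lam i = μ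
  eigen : ∀ i, IsEigenpair ρ a q₀ q₁ (lam i : ℂ) (fun z => (φ i z : ℂ))
  normalized : ∀ i, ∫ z in (0 : ℝ)..1, φ i z ^ 2 = 1

theorem IsEigensystem.memLp {ρ : ℝ} {a : ℝ → ℝ} {q₀ q₁ : ℝ} {lam : ℕ → ℝ} {φ : ℕ → ℝ → ℝ}
    (hs : IsEigensystem ρ a q₀ q₁ lam φ) (i : ℕ) :
    MemLp (fun z => (φ i z : ℂ)) 2 unitVol := by
  obtain ⟨⟨_, _, h, _⟩, _⟩ := hs.eigen i
  exact h.memLp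

/-- The eigenvector `φ i` as an element of `L₂(0,1)`. -/
def IsEigensystem.vec {ρ : ℝ} {a : ℝ → ℝ} {q₀ q₁ : ℝ} {lam : ℕ → ℝ} {φ : ℕ → ℝ → ℝ}
    (hs : IsEigensystem ρ a q₀ q₁ lam φ) (i : ℕ) : StateSpace :=
  (hs.memLp i).toLp (fun z => (φ i z : ℂ))

/-- The vector `b_i = ρ (-φ_i(0), φ_i(1))`. -/
def inputVec (ρ : ℝ) (φ : ℕ → ℝ → ℝ) (i : ℕ) : Fin 2 → ℂ :=
  ![(ρ : ℂ) * (-(φ i 0 : ℂ)), (ρ : ℂ) * (φ i 1 : ℂ)]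

/-- The matrix `B_n` with the rows `b_iᵀ` of the first `n` modes. -/
def inputMatrix (ρ : ℝ) (φ : ℕ → ℝ → ℝ) (n : ℕ) : Matrix (Fin n) (Fin 2) ℂ :=
  Matrix.of fun i => inputVec ρ φ i

/-- The matrix `Λ_n`, diagonal with the first `n` open-loop eigenvalues. -/
def lamMatrix (lam : ℕ → ℝ) (n : ℕ) : Matrix (Fin n) (Fin n) ℂ :=
  Matrix.diagonal fun i => (lam i : ℂ)

/-- The spectrum of the diagonal operator `Λ_∞` on `ℓ₂`, whose diagonal entries are the
eigenvalues after the first `n`. -/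
def spectrumTail (lam : ℕ → ℝ) (n : ℕ) : Set ℂ :=
  {μ | ∃ j, n ≤ j ∧ μ = (lam j : ℂ)}

/-- The gain `K` assigns the eigenvalues `lamt i` with the parameter vectors `p i` (the columns
of `P`) and the closed-loop eigenvectors `v i` (the columns of `V`), which are nonzero:
`(Λ_n - lamt i I) v i = B_n (p i)` and `p i = K (v i)`.
In particular `(Λ_n - B_n K) (v i) = lamt i (v i)`. -/
structure IsAssignedBy {n : ℕ} (Lam : Matrix (Fin n) (Fin n) ℂ) (B : Matrix (Fin n) (Fin 2) ℂ)
    (K : Matrix (Fin 2) (Fin n) ℂ) (lamt : Fin n → ℂ)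
    (P : Matrix (Fin 2) (Fin n) ℂ) (V : Matrix (Fin n) (Fin n) ℂ) : Prop where
  ne_zero : ∀ i, V.col i ≠ 0
  modal : ∀ i, (Lam - lamt i • (1 : Matrix (Fin n) (Fin n) ℂ)).mulVec (V.col i)
    = B.mulVec (P.col i)
  gain : ∀ i, P.col i = K.mulVec (V.col i)

/-- The row vector `c̄_iᵀ`: it is `e_iᵀ V⁻¹` for the first `n` indices and
`b_iᵀ P (Λ̃_n - λ_i I)⁻¹ V⁻¹` for the others. -/
def coeffRow (ρ : ℝ) (lam : ℕ → ℝ) (φ : ℕ → ℝ → ℝ) {n : ℕ} (lamt : Fin n → ℂ)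
    (P : Matrix (Fin 2) (Fin n) ℂ) (V : Matrix (Fin n) (Fin n) ℂ) (i : ℕ) : Fin n → ℂ :=
  if hi : i < n then V⁻¹.row ⟨i, hi⟩
  else Matrix.vecMul (inputVec ρ φ i)
    (P * (Matrix.diagonal lamt - (lam i : ℂ) • (1 : Matrix (Fin n) (Fin n) ℂ))⁻¹ * V⁻¹)

/-- The vector `ψ̃_i`: it is `c_iᵀ (φ_1, ..., φ_n)` for the first `n` indices and
`c_iᵀ (φ_1, ..., φ_n) + φ_i` for the others. -/
def closedLoopVec {ρ : ℝ} {a : ℝ → ℝ} {q₀ q₁ : ℝ} {lam : ℕ → ℝ} {φ : ℕ → ℝ → ℝ}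
    (hs : IsEigensystem ρ a q₀ q₁ lam φ) {n : ℕ} (lamt : Fin n → ℂ)
    (P : Matrix (Fin 2) (Fin n) ℂ) (V : Matrix (Fin n) (Fin n) ℂ) (i : ℕ) : StateSpace :=
  (∑ j : Fin n, star (coeffRow ρ lam φ lamt P V i j) • hs.vec j)
    + (if i < n then 0 else hs.vec i)

/-- A Riesz basis of a Hilbert space: the span of the sequence is dense, and the norm of a finite
linear combination is equivalent to the `ℓ₂`-norm of its coefficients. -/
def IsRieszBasis {H : Type*} [NormedAddCommGroup H] [InnerProductSpace ℂ H] (e : ℕ → H) : Prop :=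
  (Submodule.span ℂ (Set.range e)).topologicalClosure = ⊤ ∧
  ∃ m M : ℝ, 0 < m ∧ 0 < M ∧ ∀ (s : Finset ℕ) (α : ℕ → ℂ),
    m * ∑ i ∈ s, ‖α i‖ ^ 2 ≤ ‖∑ i ∈ s, α i • e i‖ ^ 2 ∧
    ‖∑ i ∈ s, α i • e i‖ ^ 2 ≤ M * ∑ i ∈ s, ‖α i‖ ^ 2

end

/-! The vectors `closedLoopVec` are the images of an orthonormal basis, the eigenvectors `hs.vec i`,
under identity plus a finite-rank operator `K`. The Fredholm alternative makes such a map an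
isomorphism once it is injective, and isomorphic images of orthonormal bases are Riesz bases. A
kernel vector lies in the span of the first `n` eigenvectors, where injectivity is invertibility of
`V⁻¹`; `V` is invertible because its columns are eigenvectors for distinct eigenvalues. See
`isRieszBasis_of_blockTriangular`.

Boundedness of `K` requires the coefficients `c_{i,j}` to be square-summable in `i`. No eigenvalue
or eigenfunction asymptotics are used. Green's identity with a lift `G ∈ H²` of boundary data `α`
gives `b_i · α = ⟨φ_i, F⟩ - λ_i ⟨φ_i, G⟩`, hence `(b_i · α) / (μ - λ_i) = ⟨φ_i, F - μ G⟩ / (μ - λ_i)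
+ ⟨φ_i, G⟩`. By Bessel's inequality and `λ_i → -∞` this is square-summable.

Completeness of the eigenvectors and `λ_i → -∞` both come from a compact symmetric resolvent at `κ =
lam 0 + 1`. It is obtained by writing the boundary value problem as identity plus compact in the
unknown `(h 0, h'')`. The spectral theorem applies to it, and ODE uniqueness makes every eigenspace
of the Sturm-Liouville operator one-dimensional. -/

/-! ### Integration by parts for primitives on the unit interval. -/

theorem integral_unitVol_eq_intervalIntegral {E : Type*} [NormedAddCommGroup E] [NormedSpace ℝ E]
    (f : ℝ → E) : ∫ z, f z ∂unitVol = ∫ z in (0 : ℝ)..1, f z := by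
  rw [intervalIntegral.integral_of_le zero_le_one, integral_Ioc_eq_integral_Ioo]

theorem MeasureTheory.Integrable.intervalIntegrable_unitVol {E : Type*} [NormedAddCommGroup E]
    {f : ℝ → E} (hf : Integrable f unitVol) {x y : ℝ} (hx : x ∈ Set.Icc (0 : ℝ) 1)
    (hy : y ∈ Set.Icc (0 : ℝ) 1) : IntervalIntegrable f volume x y := by
  have h : IntervalIntegrable f volume 0 1 := by
    rw [intervalIntegrable_iff_integrableOn_Ioo_of_le zero_le_one]
    exact hf
  refine h.mono_set ?_
  rw [Set.uIcc_of_le zero_le_one]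
  exact Set.uIcc_subset_Icc hx hy

theorem MeasureTheory.Integrable.continuousOn_primitive_unitVol {f : ℝ → ℂ}
    (hf : Integrable f unitVol) :
    ContinuousOn (fun z => ∫ t in (0 : ℝ)..z, f t) (Set.Icc 0 1) := by
  have h := hf.intervalIntegrable_unitVol (x := 0) (y := 1) (by simp) (by simp)
  have := intervalIntegral.continuousOn_primitive_interval' (a := 0) h (by simp)
  rwa [Set.uIcc_of_le zero_le_one] at this

theorem ContinuousOn.memLp_unitVol {f : ℝ → ℂ} (hf : ContinuousOn f (Set.Icc 0 1))
    (p : ENNReal) : MemLp f p unitVol := by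
  obtain ⟨C, hC⟩ := isCompact_Icc.exists_bound_of_continuousOn hf
  refine MemLp.of_bound ((hf.mono Set.Ioo_subset_Icc_self).aestronglyMeasurable measurableSet_Ioo)
    C ?_
  filter_upwards [ae_restrict_mem measurableSet_Ioo] with z hz
  exact hC z (Set.Ioo_subset_Icc_self hz)

/-- Fubini on the unit square cut along its diagonal. This yields integration by parts from the
primitive property alone, without differentiating almost everywhere. -/
theorem integral_mul_primitive_add {f g : ℝ → ℂ} (hf : Integrable f unitVol)
    (hg : Integrable g unitVol) :
    (∫ z, g z * (∫ t in (0 : ℝ)..z, f t) ∂unitVol) + (∫ z, f z * (∫ t in (0 : ℝ)..z, g t) ∂unitVol)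
      = (∫ z, f z ∂unitVol) * ∫ z, g z ∂unitVol := by
  set S : Set (ℝ × ℝ) := {p | p.2 < p.1} with hS
  have hSm : MeasurableSet S := measurableSet_lt measurable_snd measurable_fst
  have hint : Integrable (S.indicator fun p : ℝ × ℝ => g p.1 * f p.2) (unitVol.prod unitVol) :=
    (hg.mul_prod hf).indicator hSm
  have hswap := integral_integral_swap (μ := unitVol) (ν := unitVol)
    (f := fun z t => S.indicator (fun p : ℝ × ℝ => g p.1 * f p.2) (z, t)) hint
  have h1 : ∫ z, (∫ t, S.indicator (fun p : ℝ × ℝ => g p.1 * f p.2) (z, t) ∂unitVol) ∂unitVol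
      = ∫ z, g z * (∫ t in (0 : ℝ)..z, f t) ∂unitVol := by
    refine integral_congr_ae ?_
    filter_upwards [ae_restrict_mem measurableSet_Ioo] with z hz
    have : (fun t => S.indicator (fun p : ℝ × ℝ => g p.1 * f p.2) (z, t))
        = (Set.Iio z).indicator fun t => g z * f t := by
      ext t; simp [Set.indicator, hS]
    rw [this, integral_indicator measurableSet_Iio, Measure.restrict_restrict measurableSet_Iio,
      integral_const_mul, intervalIntegral.integral_of_le hz.1.le, integral_Ioc_eq_integral_Ioo]
    congr 3
    ext t; simp only [Set.mem_inter_iff, Set.mem_Iio, Set.mem_Ioo]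
    constructor
    · rintro ⟨h, h', -⟩; exact ⟨h', h⟩
    · rintro ⟨h, h'⟩; exact ⟨h', h, h'.trans hz.2⟩
  have h2 : ∫ t, (∫ z, S.indicator (fun p : ℝ × ℝ => g p.1 * f p.2) (z, t) ∂unitVol) ∂unitVol
      = ∫ t, (f t * (∫ z, g z ∂unitVol) - f t * (∫ z in (0 : ℝ)..t, g z)) ∂unitVol := by
    refine integral_congr_ae ?_
    filter_upwards [ae_restrict_mem measurableSet_Ioo] with t ht
    have : (fun z => S.indicator (fun p : ℝ × ℝ => g p.1 * f p.2) (z, t))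
        = (Set.Ioi t).indicator fun z => f t * g z := by
      ext z; simp [Set.indicator, hS, mul_comm]
    rw [this, integral_indicator measurableSet_Ioi, Measure.restrict_restrict measurableSet_Ioi,
      integral_const_mul, ← mul_sub, integral_unitVol_eq_intervalIntegral,
      intervalIntegral.integral_interval_sub_left, intervalIntegral.integral_of_le ht.2.le,
      integral_Ioc_eq_integral_Ioo]
    · congr 3
      ext z; simp only [Set.mem_inter_iff, Set.mem_Ioi, Set.mem_Ioo]
      constructor
      · rintro ⟨h, -, h'⟩; exact ⟨h, h'⟩
      · rintro ⟨h, h'⟩; exact ⟨h, ht.1.trans h, h'⟩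
    · exact hg.intervalIntegrable_unitVol (by simp) (by simp)
    · exact hg.intervalIntegrable_unitVol (by simp) ⟨ht.1.le, ht.2.le⟩
  have hi : Integrable (fun t => f t * (∫ z in (0 : ℝ)..t, g z)) unitVol :=
    hf.mul_of_top_left (hg.continuousOn_primitive_unitVol.memLp_unitVol ⊤)
  rw [h1, h2, integral_sub (hf.mul_const _) hi, integral_mul_const] at hswap
  rw [hswap]
  ring

theorem integral_mul_add_mul_of_primitive {F G f g : ℝ → ℂ} (hf : Integrable f unitVol)
    (hg : Integrable g unitVol)
    (hF : ∀ z ∈ Set.Icc (0 : ℝ) 1, F z = F 0 + ∫ t in (0 : ℝ)..z, f t)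
    (hG : ∀ z ∈ Set.Icc (0 : ℝ) 1, G z = G 0 + ∫ t in (0 : ℝ)..z, g t) :
    (∫ z, f z * G z ∂unitVol) + (∫ z, F z * g z ∂unitVol) = F 1 * G 1 - F 0 * G 0 := by
  have aux : ∀ {G f g : ℝ → ℂ}, Integrable f unitVol → Integrable g unitVol →
      (∀ z ∈ Set.Icc (0 : ℝ) 1, G z = G 0 + ∫ t in (0 : ℝ)..z, g t) →
      ∫ z, f z * G z ∂unitVol = (∫ z, f z ∂unitVol) * G 0 +
        ∫ z, f z * (∫ t in (0 : ℝ)..z, g t) ∂unitVol := by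
    intro G f g hf hg hG
    have hi : Integrable (fun t => f t * (∫ z in (0 : ℝ)..t, g z)) unitVol :=
      hf.mul_of_top_left (hg.continuousOn_primitive_unitVol.memLp_unitVol ⊤)
    rw [← integral_mul_const, ← integral_add (hf.mul_const _) hi]
    refine integral_congr_ae ?_
    filter_upwards [ae_restrict_mem measurableSet_Ioo] with z hz
    rw [hG z (Set.Ioo_subset_Icc_self hz)]
    ring
  have h := integral_mul_primitive_add hf hg
  simp_rw [mul_comm (F _)]
  rw [aux hf hg hG, aux hg hf hF, hF 1 (by simp), hG 1 (by simp),
    ← integral_unitVol_eq_intervalIntegral, ← integral_unitVol_eq_intervalIntegral]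
  linear_combination h

/-! ### Functions in `H²(0,1)`: Green's identity and ODE uniqueness. -/

namespace IsSobolevH2

variable {h h₁ h₂ k k₁ k₂ : ℝ → ℂ}

theorem continuousOn (H : IsSobolevH2 h h₁ h₂) : ContinuousOn h (Set.Icc 0 1) :=
  (continuousOn_const.add
    (H.memLp_one.integrable one_le_two).continuousOn_primitive_unitVol).congr H.primitive_one

theorem continuousOn_deriv (H : IsSobolevH2 h h₁ h₂) : ContinuousOn h₁ (Set.Icc 0 1) :=
  (continuousOn_const.add
    (H.memLp_two.integrable one_le_two).continuousOn_primitive_unitVol).congr H.primitive_two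

theorem green (H : IsSobolevH2 h h₁ h₂) (K : IsSobolevH2 k k₁ k₂) :
    (∫ z, h₂ z * k z ∂unitVol) - (∫ z, h z * k₂ z ∂unitVol)
      = (h₁ 1 * k 1 - h 1 * k₁ 1) - (h₁ 0 * k 0 - h 0 * k₁ 0) := by
  have e1 := integral_mul_add_mul_of_primitive (H.memLp_two.integrable one_le_two)
    (K.memLp_one.integrable one_le_two) H.primitive_two K.primitive_one
  have e2 := integral_mul_add_mul_of_primitive (H.memLp_one.integrable one_le_two)
    (K.memLp_two.integrable one_le_two) H.primitive_one K.primitive_two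
  linear_combination e1 - e2

theorem add (H : IsSobolevH2 h h₁ h₂) (K : IsSobolevH2 k k₁ k₂) :
    IsSobolevH2 (h + k) (h₁ + k₁) (h₂ + k₂) where
  memLp := H.memLp.add K.memLp
  memLp_one := H.memLp_one.add K.memLp_one
  memLp_two := H.memLp_two.add K.memLp_two
  primitive_one z hz := by
    simp only [Pi.add_apply]
    rw [intervalIntegral.integral_add, H.primitive_one z hz, K.primitive_one z hz]
    · ring
    · exact (H.memLp_one.integrable one_le_two).intervalIntegrable_unitVol (by simp) hz
    · exact (K.memLp_one.integrable one_le_two).intervalIntegrable_unitVol (by simp) hz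
  primitive_two z hz := by
    simp only [Pi.add_apply]
    rw [intervalIntegral.integral_add, H.primitive_two z hz, K.primitive_two z hz]
    · ring
    · exact (H.memLp_two.integrable one_le_two).intervalIntegrable_unitVol (by simp) hz
    · exact (K.memLp_two.integrable one_le_two).intervalIntegrable_unitVol (by simp) hz

theorem const_smul (H : IsSobolevH2 h h₁ h₂) (c : ℂ) :
    IsSobolevH2 (c • h) (c • h₁) (c • h₂) where
  memLp := H.memLp.const_smul c
  memLp_one := H.memLp_one.const_smul c
  memLp_two := H.memLp_two.const_smul c
  primitive_one z hz := by
    simp only [Pi.smul_apply, intervalIntegral.integral_smul, ← smul_add, H.primitive_one z hz]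
  primitive_two z hz := by
    simp only [Pi.smul_apply, intervalIntegral.integral_smul, ← smul_add, H.primitive_two z hz]

theorem star (H : IsSobolevH2 h h₁ h₂) : IsSobolevH2 (star h) (star h₁) (star h₂) where
  memLp := H.memLp.star
  memLp_one := H.memLp_one.star
  memLp_two := H.memLp_two.star
  primitive_one z hz := by
    have := congrArg (starRingEnd ℂ) (H.primitive_one z hz)
    rw [map_add, intervalIntegral.integral_of_le hz.1, ← integral_conj,
      ← intervalIntegral.integral_of_le hz.1] at this
    exact this
  primitive_two z hz := by
    have := congrArg (starRingEnd ℂ) (H.primitive_two z hz)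
    rw [map_add, intervalIntegral.integral_of_le hz.1, ← integral_conj,
      ← intervalIntegral.integral_of_le hz.1] at this
    exact this

/-- A solution of the linear equation `h'' = c h` with continuous coefficient and vanishing initial
data vanishes. -/
theorem eqOn_zero_of_ae_eq_mul (H : IsSobolevH2 h h₁ h₂) {c : ℝ → ℂ}
    (hc : ContinuousOn c (Set.Icc 0 1)) (hh : ∀ᵐ z ∂unitVol, h₂ z = c z * h z)
    (h0 : h 0 = 0) (h10 : h₁ 0 = 0) : Set.EqOn h 0 (Set.Icc 0 1) := by
  obtain ⟨C, hC⟩ := isCompact_Icc.exists_bound_of_continuousOn hc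
  have hC0 : 0 ≤ C := (norm_nonneg _).trans (hC 0 (by simp))
  -- Right derivatives suffice for the uniqueness theorem and are all that is available at `0`,
  -- since nothing is known outside `[0,1]`.
  have hder : ∀ {u v : ℝ → ℂ}, ContinuousOn v (Set.Icc 0 1) →
      (∀ z ∈ Set.Icc (0 : ℝ) 1, u z = u 0 + ∫ t in (0 : ℝ)..z, v t) →
      ∀ t ∈ Set.Ico (0 : ℝ) 1, HasDerivWithinAt u (v t) (Set.Ici t) t := by
    intro u v hv hu t ht
    have hd : HasDerivWithinAt (fun z => u 0 + ∫ s in (0 : ℝ)..z, v s) (v t) (Set.Ici t) t := by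
      refine HasDerivWithinAt.const_add _ ?_
      refine intervalIntegral.integral_hasDerivWithinAt_right (t := Set.Ioi t) ?_ ?_ ?_
      · exact ((hv.memLp_unitVol 1).integrable le_rfl).intervalIntegrable_unitVol (by simp)
          ⟨ht.1, ht.2.le⟩
      · have : Set.Ioo t 1 ∈ nhdsWithin t (Set.Ioi t) := Ioo_mem_nhdsGT ht.2
        exact ⟨Set.Ioo t 1, this, (hv.mono (fun s hs =>
          ⟨ht.1.trans hs.1.le, hs.2.le⟩)).aestronglyMeasurable measurableSet_Ioo⟩
      · have : ContinuousWithinAt v (Set.Icc 0 1) t := hv t ⟨ht.1, ht.2.le⟩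
        refine this.mono_of_mem_nhdsWithin ?_
        exact Filter.mem_of_superset (Ioo_mem_nhdsGT ht.2)
          fun s hs => ⟨ht.1.trans hs.1.le, hs.2.le⟩
    refine hd.congr_of_eventuallyEq ?_ (hu t ⟨ht.1, ht.2.le⟩)
    filter_upwards [Ico_mem_nhdsGE ht.2] with s hs
    exact hu s ⟨ht.1.trans hs.1, hs.2.le⟩
  have hch : ContinuousOn (fun z => c z * h z) (Set.Icc 0 1) := hc.mul H.continuousOn
  -- Replacing `h₂` by the continuous `c h` makes `h₁` differentiable from the right at every point,
  -- not just almost every one.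
  have hprim : ∀ z ∈ Set.Icc (0 : ℝ) 1, h₁ z = h₁ 0 + ∫ t in (0 : ℝ)..z, c t * h t := by
    intro z hz
    rw [H.primitive_two z hz]
    congr 1
    refine intervalIntegral.integral_congr_ae ?_
    have := (ae_restrict_iff' measurableSet_Ioo).1 hh
    have h1 : ∀ᵐ t : ℝ, t ≠ 1 := by simp [ae_iff]
    filter_upwards [this, h1] with t ht ht1 htz
    rw [Set.uIoc_of_le hz.1] at htz
    exact ht ⟨htz.1, lt_of_le_of_ne (htz.2.trans hz.2) ht1⟩
  have key : Set.EqOn (fun z => (h z, h₁ z)) (fun _ => (0, 0)) (Set.Icc 0 1) := by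
    -- First-order system for `(h, h')`; in the sup norm of the product its Lipschitz constant is
    -- `max 1 C`.
    refine ODE_solution_unique_of_mem_Icc_right (K := Real.toNNReal (max 1 C))
      (v := fun t (x : ℂ × ℂ) => (x.2, c t * x.1)) (s := fun _ => Set.univ) ?_
      (H.continuousOn.prodMk H.continuousOn_deriv) ?_ (fun _ _ => trivial) continuousOn_const ?_
      (fun _ _ => trivial) (by simp [h0, h10])
    · intro t ht
      refine LipschitzWith.lipschitzOnWith (LipschitzWith.of_dist_le_mul fun x y => ?_)
      rw [Real.coe_toNNReal _ (le_max_of_le_left zero_le_one), Prod.dist_eq]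
      have hd := dist_nonneg (x := x) (y := y)
      refine max_le ?_ ?_
      · calc dist x.2 y.2 ≤ dist x y := le_max_right _ _
          _ ≤ max 1 C * dist x y := le_mul_of_one_le_left hd (le_max_left _ _)
      · calc dist (c t * x.1) (c t * y.1) = ‖c t‖ * dist x.1 y.1 := by
              rw [dist_eq_norm, dist_eq_norm, ← mul_sub, norm_mul]
          _ ≤ max 1 C * dist x y :=
              mul_le_mul ((hC t ⟨ht.1, ht.2.le⟩).trans (le_max_right _ _)) (le_max_left _ _)
                dist_nonneg (le_max_of_le_left zero_le_one)
    · intro t ht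
      exact (hder H.continuousOn_deriv H.primitive_one t ht).prodMk (hder hch hprim t ht)
    · intro t ht
      simpa using! hasDerivWithinAt_const t (Set.Ici t) ((0, 0) : ℂ × ℂ)
  intro z hz
  exact congrArg Prod.fst (key hz)

end IsSobolevH2

/-! ### The Sturm-Liouville operator: symmetry and simple eigenvalues. -/

namespace SLGraph

variable {ρ : ℝ} {a : ℝ → ℝ} {q₀ q₁ : ℝ} {h g k l : ℝ → ℂ}

theorem continuousOn (H : SLGraph ρ a q₀ q₁ h g) : ContinuousOn h (Set.Icc 0 1) := by
  obtain ⟨_, _, H, -⟩ := H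
  exact H.continuousOn

theorem eqOn_zero (H : SLGraph ρ a q₀ q₁ h g) (h0 : ∀ᵐ z ∂unitVol, h z = 0) :
    Set.EqOn h 0 (Set.Icc 0 1) := by
  refine Measure.eqOn_Icc_of_ae_eq volume zero_ne_one ?_ H.continuousOn continuousOn_const
  rw [restrict_Ioo_eq_restrict_Icc.symm]
  exact h0

theorem congr_ae (H : SLGraph ρ a q₀ q₁ h g) (hg : k =ᵐ[unitVol] g) : SLGraph ρ a q₀ q₁ h k := by
  obtain ⟨h₁, h₂, H, b0, b1, he⟩ := H
  exact ⟨h₁, h₂, H, b0, b1, by filter_upwards [he, hg] with z hz hz' using hz'.trans hz⟩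

theorem add (H : SLGraph ρ a q₀ q₁ h g) (K : SLGraph ρ a q₀ q₁ k l) :
    SLGraph ρ a q₀ q₁ (h + k) (g + l) := by
  obtain ⟨h₁, h₂, H, b0, b1, he⟩ := H
  obtain ⟨k₁, k₂, K, c0, c1, ke⟩ := K
  refine ⟨_, _, H.add K, ?_, ?_, ?_⟩
  · simp only [Pi.add_apply, b0, c0]; ring
  · simp only [Pi.add_apply, b1, c1]; ring
  · filter_upwards [he, ke] with z hz kz
    simp only [Pi.add_apply, hz, kz]; ring

theorem const_smul (H : SLGraph ρ a q₀ q₁ h g) (c : ℂ) :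
    SLGraph ρ a q₀ q₁ (c • h) (c • g) := by
  obtain ⟨h₁, h₂, H, b0, b1, he⟩ := H
  refine ⟨_, _, H.const_smul c, ?_, ?_, ?_⟩
  · simp only [Pi.smul_apply, smul_eq_mul, b0]; ring
  · simp only [Pi.smul_apply, smul_eq_mul, b1]; ring
  · filter_upwards [he] with z hz
    simp only [Pi.smul_apply, smul_eq_mul, hz]; ring

theorem star (H : SLGraph ρ a q₀ q₁ h g) : SLGraph ρ a q₀ q₁ (star h) (star g) := by
  obtain ⟨h₁, h₂, H, b0, b1, he⟩ := H
  refine ⟨_, _, H.star, ?_, ?_, ?_⟩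
  · simp [b0]
  · simp [b1]
  · filter_upwards [he] with z hz
    simp [hz]

/-- Green's identity for a function `h` in `H²(0,1)` and a function `k` satisfying the boundary
conditions. -/
theorem green {h₁ h₂ : ℝ → ℂ} (ha : ContinuousOn a (Set.Icc 0 1)) (H : IsSobolevH2 h h₁ h₂)
    (K : SLGraph ρ a q₀ q₁ k l) :
    (∫ z, (ρ * h₂ z + a z * h z) * k z ∂unitVol) - (∫ z, h z * l z ∂unitVol)
      = ρ * ((h₁ 1 - q₁ * h 1) * k 1 - (h₁ 0 - q₀ * h 0) * k 0) := by
  obtain ⟨k₁, k₂, K, c0, c1, ke⟩ := K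
  have hac : ContinuousOn (fun z => (a z : ℂ)) (Set.Icc 0 1) :=
    Complex.continuous_ofReal.comp_continuousOn ha
  have hk : MemLp k ⊤ unitVol := K.continuousOn.memLp_unitVol ⊤
  have hh : MemLp h ⊤ unitVol := H.continuousOn.memLp_unitVol ⊤
  have i1 : Integrable (fun z => ρ * (h₂ z * k z)) unitVol :=
    ((H.memLp_two.integrable one_le_two).mul_of_top_left hk).const_mul _
  have i2 : Integrable (fun z => a z * h z * k z) unitVol :=
    (((hac.mul H.continuousOn).mul K.continuousOn).memLp_unitVol 1).integrable le_rfl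
  have i3 : Integrable (fun z => ρ * (h z * k₂ z)) unitVol :=
    ((K.memLp_two.integrable one_le_two).mul_of_top_right hh).const_mul _
  have e1 : ∫ z, (ρ * h₂ z + a z * h z) * k z ∂unitVol
      = ρ * (∫ z, h₂ z * k z ∂unitVol) + ∫ z, a z * h z * k z ∂unitVol := by
    rw [← integral_const_mul, ← integral_add i1 i2]
    refine integral_congr_ae (Filter.Eventually.of_forall fun z => ?_)
    simp only
    ring
  have e2 : ∫ z, h z * l z ∂unitVol
      = ρ * (∫ z, h z * k₂ z ∂unitVol) + ∫ z, a z * h z * k z ∂unitVol := by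
    rw [← integral_const_mul, ← integral_add i3 i2]
    refine integral_congr_ae ?_
    filter_upwards [ke] with z hz
    rw [hz]
    ring
  have := H.green K
  rw [c0, c1] at this
  rw [e1, e2]
  linear_combination ρ * this

theorem integral_mul_comm (ha : ContinuousOn a (Set.Icc 0 1)) (H : SLGraph ρ a q₀ q₁ h g)
    (K : SLGraph ρ a q₀ q₁ k l) :
    ∫ z, g z * k z ∂unitVol = ∫ z, h z * l z ∂unitVol := by
  obtain ⟨h₁, h₂, H, b0, b1, he⟩ := H
  have := green ha H K
  rw [b0, b1, sub_self, sub_self, zero_mul, zero_mul, sub_zero, mul_zero, sub_eq_zero] at this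
  rw [← this]
  refine integral_congr_ae ?_
  filter_upwards [he] with z hz
  rw [hz]

/-- Two solutions of the eigenvalue equation for the same eigenvalue are linearly dependent. -/
theorem eqOn_smul_of_eigen (hρ : ρ ≠ 0) (ha : ContinuousOn a (Set.Icc 0 1)) {μ : ℂ}
    (H : SLGraph ρ a q₀ q₁ h fun z => μ * h z) (K : SLGraph ρ a q₀ q₁ k fun z => μ * k z)
    (hk : ¬ ∀ᵐ z ∂unitVol, k z = 0) :
    Set.EqOn h ((h 0 / k 0) • k) (Set.Icc 0 1) := by
  have hρ' : (ρ : ℂ) ≠ 0 := Complex.ofReal_ne_zero.2 hρ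
  have hc : ContinuousOn (fun z => (μ - a z) / (ρ : ℂ)) (Set.Icc 0 1) :=
    (continuousOn_const.sub (Complex.continuous_ofReal.comp_continuousOn ha)).div_const _
  have van : ∀ {u : ℝ → ℂ}, SLGraph ρ a q₀ q₁ u (fun z => μ * u z) → u 0 = 0 →
      Set.EqOn u 0 (Set.Icc 0 1) := by
    rintro u ⟨u₁, u₂, U, b0, -, ue⟩ u0
    refine U.eqOn_zero_of_ae_eq_mul hc ?_ u0 (by rw [b0, u0, mul_zero])
    filter_upwards [ue] with z hz
    field_simp
    linear_combination -hz
  -- The boundary condition turns `k 0 = 0` into vanishing initial data, so an eigenfunction is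
  -- determined by its value at `0`.
  have k0 : k 0 ≠ 0 := by
    intro k0
    refine hk ?_
    filter_upwards [ae_restrict_mem measurableSet_Ioo] with z hz
    exact van K k0 (Set.Ioo_subset_Icc_self hz)
  have W := H.add (K.const_smul (-(h 0 / k 0)))
  have hW := van (W.congr_ae (Filter.Eventually.of_forall fun z => by
    simp only [Pi.add_apply, Pi.smul_apply, smul_eq_mul]; ring)) (by
      simp only [Pi.add_apply, Pi.smul_apply, smul_eq_mul]; field_simp; ring)
  intro z hz
  have := hW hz
  simp only [Pi.add_apply, Pi.smul_apply, smul_eq_mul, Pi.zero_apply] at this ⊢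
  linear_combination this

end SLGraph

theorem ae_eq_zero_of_primitive_eq_zero {f : ℝ → ℂ} (hf : Integrable f unitVol)
    (h : ∀ z ∈ Set.Icc (0 : ℝ) 1, ∫ t in (0 : ℝ)..z, f t = 0) : ∀ᵐ z ∂unitVol, f z = 0 := by
  have hi := hf.intervalIntegrable_unitVol (x := 0) (y := 1) (by simp) (by simp)
  have := hi.ae_hasDerivAt_integral
  rw [ae_restrict_iff' measurableSet_Ioo]
  filter_upwards [this] with z hz hz1
  have hd := hz (by rw [Set.uIcc_of_le zero_le_one]; exact Set.Ioo_subset_Icc_self hz1) 0 (by simp)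
  have h0 : HasDerivAt (fun z => ∫ t in (0 : ℝ)..z, f t) 0 z := by
    refine (hasDerivAt_const z (0 : ℂ)).congr_of_eventuallyEq ?_
    filter_upwards [Ioo_mem_nhds hz1.1 hz1.2] with y hy
    exact h y (Set.Ioo_subset_Icc_self hy)
  exact hd.unique h0

/-- The graph is single-valued at zero. This will show that the resolvent is injective. -/
theorem SLGraph.ae_eq_zero {ρ : ℝ} {a : ℝ → ℝ} {q₀ q₁ : ℝ} {h g : ℝ → ℂ}
    (H : SLGraph ρ a q₀ q₁ h g) (h0 : ∀ᵐ z ∂unitVol, h z = 0) : ∀ᵐ z ∂unitVol, g z = 0 := by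
  have e := H.eqOn_zero h0
  obtain ⟨h₁, h₂, H, b0, b1, he⟩ := H
  have h00 : h 0 = 0 := e (by simp)
  have h1 : ∀ᵐ z ∂unitVol, h₁ z = 0 := by
    refine ae_eq_zero_of_primitive_eq_zero (H.memLp_one.integrable one_le_two) fun z hz => ?_
    have := H.primitive_one z hz
    rw [e hz, h00, Pi.zero_apply, zero_add] at this
    exact this.symm
  have e1 : Set.EqOn h₁ 0 (Set.Icc 0 1) := by
    refine Measure.eqOn_Icc_of_ae_eq volume zero_ne_one ?_ H.continuousOn_deriv continuousOn_const
    rw [restrict_Ioo_eq_restrict_Icc.symm]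
    exact h1
  have h2 : ∀ᵐ z ∂unitVol, h₂ z = 0 := by
    refine ae_eq_zero_of_primitive_eq_zero (H.memLp_two.integrable one_le_two) fun z hz => ?_
    have := H.primitive_two z hz
    rw [e1 hz, e1 (by simp : (0 : ℝ) ∈ Set.Icc (0 : ℝ) 1), Pi.zero_apply, Pi.zero_apply,
      zero_add] at this
    exact this.symm
  filter_upwards [he, h0, h2] with z hz hz0 hz2
  rw [hz, hz0, hz2, mul_zero, mul_zero, add_zero]

/-! ### Compact operators: the Fredholm alternative and the Volterra operator. -/

/-- The Fredholm alternative for the identity plus a compact operator. -/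
theorem IsCompactOperator.exists_equiv_one_add {E : Type*} [NormedAddCommGroup E] [NormedSpace ℂ E]
    [CompleteSpace E] {K : E →L[ℂ] E} (hK : IsCompactOperator K)
    (hinj : ∀ x, x + K x = 0 → x = 0) : ∃ e : E ≃L[ℂ] E, ∀ x, e x = x + K x := by
  rcases hK.hasEigenvalue_or_mem_resolventSet (μ := (-1 : ℂ)) (by norm_num) with h | h
  · obtain ⟨x, hx⟩ := h.exists_hasEigenvector
    refine absurd (hinj x ?_) hx.2
    have := hx.apply_eq_smul
    rw [ContinuousLinearMap.coe_coe] at this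
    rw [this]; simp
  · have hu : IsUnit (1 + K) := by
      rw [spectrum.mem_resolventSet_iff] at h
      convert h.neg using 1
      simp [add_comm]
    obtain ⟨u, hu⟩ := hu
    refine ⟨ContinuousLinearEquiv.unitsEquiv ℂ E u, fun x => ?_⟩
    rw [ContinuousLinearEquiv.unitsEquiv_apply, hu]
    simp

noncomputable section

/-- Integration over the interval `(x, y)` as a bounded functional. -/
def integralIoo (x y : ℝ) : StateSpace →L[ℂ] ℂ :=
  innerSL ℂ (indicatorConstLp 2 (measurableSet_Ioo (a := x) (b := y)) (measure_ne_top unitVol _)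
    (1 : ℂ))

theorem integralIoo_apply {x y : ℝ} (hx : 0 ≤ x) (hxy : x ≤ y) (hy : y ≤ 1) (g : StateSpace) :
    integralIoo x y g = ∫ t in x..y, g t := by
  rw [integralIoo, innerSL_apply_apply, L2.inner_indicatorConstLp_one,
    Measure.restrict_restrict measurableSet_Ioo,
    Set.inter_eq_self_of_subset_left (Set.Ioo_subset_Ioo hx hy),
    intervalIntegral.integral_of_le hxy, integral_Ioc_eq_integral_Ioo]

/-- Cauchy-Schwarz against the indicator of `(x, y)`. The factor `√(y - x)` drives the norm
approximation of `volterra`. -/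
theorem norm_intervalIntegral_le {x y : ℝ} (hx : 0 ≤ x) (hxy : x ≤ y) (hy : y ≤ 1)
    (g : StateSpace) : ‖∫ t in x..y, g t‖ ≤ √(y - x) * ‖g‖ := by
  rw [← integralIoo_apply hx hxy hy, integralIoo, innerSL_apply_apply]
  refine (norm_inner_le_norm _ _).trans_eq ?_
  rw [norm_indicatorConstLp (by norm_num) (by norm_num), measureReal_restrict_apply
    measurableSet_Ioo, Set.inter_eq_self_of_subset_left (Set.Ioo_subset_Ioo hx hy),
    Real.volume_real_Ioo_of_le hxy, Real.sqrt_eq_rpow]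
  simp

theorem memLp_primitive (g : StateSpace) :
    MemLp (fun z => ∫ t in (0 : ℝ)..z, g t) 2 unitVol :=
  (((Lp.memLp g).integrable one_le_two).continuousOn_primitive_unitVol).memLp_unitVol 2

instance : IsProbabilityMeasure unitVol := ⟨by simp [unitVol]⟩

theorem Lp.norm_le_of_ae_le_unitVol {f : StateSpace} {C : ℝ} (hC : 0 ≤ C)
    (hf : ∀ᵐ z ∂unitVol, ‖f z‖ ≤ C) : ‖f‖ ≤ C := by
  have := Lp.norm_le_of_ae_bound hC hf
  simpa [measureUnivNNReal] using this

/-- The Volterra operator `g ↦ ∫₀ᶻ g` on `L₂(0,1)`. -/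
def volterra : StateSpace →L[ℂ] StateSpace :=
  LinearMap.mkContinuous
    { toFun := fun g => (memLp_primitive g).toLp
      map_add' := fun f g => by
        rw [← MemLp.toLp_add]
        refine MemLp.toLp_congr _ _ ?_
        filter_upwards [ae_restrict_mem measurableSet_Ioo] with z hz
        have hz' := Set.Ioo_subset_Icc_self hz
        have e := fun h : StateSpace => integralIoo_apply le_rfl hz'.1 hz'.2 h
        simp only [Pi.add_apply, ← e, map_add]
      map_smul' := fun c g => by
        rw [RingHom.id_apply, ← MemLp.toLp_const_smul]
        refine MemLp.toLp_congr _ _ ?_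
        filter_upwards [ae_restrict_mem measurableSet_Ioo] with z hz
        have hz' := Set.Ioo_subset_Icc_self hz
        have e := fun h : StateSpace => integralIoo_apply le_rfl hz'.1 hz'.2 h
        simp only [Pi.smul_apply, ← e, map_smul] }
    1 fun g => by
      rw [one_mul]
      refine Lp.norm_le_of_ae_le_unitVol (norm_nonneg _) ?_
      filter_upwards [ae_restrict_mem measurableSet_Ioo, (memLp_primitive g).coeFn_toLp] with z hz e
      rw [LinearMap.coe_mk, AddHom.coe_mk, e]
      refine (norm_intervalIntegral_le le_rfl hz.1.le hz.2.le g).trans ?_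
      refine mul_le_of_le_one_left (norm_nonneg _) (Real.sqrt_le_one.2 ?_)
      linarith [hz.2]

theorem volterra_coeFn (g : StateSpace) :
    volterra g =ᵐ[unitVol] fun z => ∫ t in (0 : ℝ)..z, g t :=
  (memLp_primitive g).coeFn_toLp

/-- The finite-rank operator that evaluates the primitive of `g` at the left end of each interval
`[k/N, (k+1)/N)`. -/
def volterraApprox (N : ℕ) : StateSpace →L[ℂ] StateSpace :=
  ∑ k ∈ Finset.range N, (integralIoo 0 (k / N)).smulRight
    (indicatorConstLp 2 (measurableSet_Ico (a := (k / N : ℝ)) (b := (k + 1) / N))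
      (measure_ne_top unitVol _) (1 : ℂ))

theorem isCompactOperator_smulRight {E F : Type*} [NormedAddCommGroup E] [NormedSpace ℂ E]
    [NormedAddCommGroup F] [NormedSpace ℂ F] (l : E →L[ℂ] ℂ) (x : F) :
    IsCompactOperator (l.smulRight x) :=
  (isCompactOperator_of_locallyCompactSpace_rng (ContinuousLinearMap.toSpanSingleton ℂ x)).comp_clm l

theorem isCompactOperator_sum {ι E F : Type*} [NormedAddCommGroup E] [NormedSpace ℂ E]
    [NormedAddCommGroup F] [NormedSpace ℂ F] (s : Finset ι) (T : ι → E →L[ℂ] F)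
    (hT : ∀ i ∈ s, IsCompactOperator (T i)) : IsCompactOperator (∑ i ∈ s, T i : E →L[ℂ] F) := by
  classical
  induction s using Finset.induction_on with
  | empty => simpa using! isCompactOperator_zero
  | insert i s hi ih =>
    rw [Finset.sum_insert hi]
    exact (hT i (by simp)).add (ih fun j hj => hT j (by simp [hj]))

theorem volterraApprox_coeFn (N : ℕ) (g : StateSpace) :
    ∀ᵐ z ∂unitVol, volterraApprox N g z = ∫ t in (0 : ℝ)..(⌊N * z⌋₊ / N), g t := by
  rcases Nat.eq_zero_or_pos N with rfl | hN
  · simp [volterraApprox]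
  have hN' : (0 : ℝ) < N := Nat.cast_pos.2 hN
  have e1 : volterraApprox N g = ∑ k ∈ Finset.range N, integralIoo 0 (k / N) g •
      indicatorConstLp 2 (measurableSet_Ico (a := (k / N : ℝ)) (b := (k + 1) / N))
      (measure_ne_top unitVol _) (1 : ℂ) := by
    simp [volterraApprox]
  have e2 : ∀ᵐ z ∂unitVol, ∀ k : ℕ, (integralIoo 0 (k / N) g •
      indicatorConstLp 2 (measurableSet_Ico (a := (k / N : ℝ)) (b := (k + 1) / N))
      (measure_ne_top unitVol _) (1 : ℂ) : StateSpace) z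
      = (Set.Ico (k / N : ℝ) ((k + 1) / N)).indicator (fun _ => integralIoo 0 (k / N) g) z := by
    rw [ae_all_iff]
    intro k
    filter_upwards [Lp.coeFn_smul (integralIoo 0 (k / N) g)
      (indicatorConstLp 2 (measurableSet_Ico (a := (k / N : ℝ)) (b := (k + 1) / N))
      (measure_ne_top unitVol _) (1 : ℂ)), indicatorConstLp_coeFn (p := 2)
      (hs := measurableSet_Ico (a := (k / N : ℝ)) (b := (k + 1) / N))
      (hμs := measure_ne_top unitVol _) (c := (1 : ℂ))] with z h1 h2
    rw [h1, Pi.smul_apply, h2]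
    by_cases hz : z ∈ Set.Ico (k / N : ℝ) ((k + 1) / N) <;> simp [hz]
  rw [e1]
  filter_upwards [ae_restrict_mem measurableSet_Ioo, e2, Lp.coeFn_finsetSum (Finset.range N)
    fun k : ℕ => integralIoo 0 (k / N) g •
      indicatorConstLp 2 (measurableSet_Ico (a := (k / N : ℝ)) (b := (k + 1) / N))
      (measure_ne_top unitVol _) (1 : ℂ)] with z hz h2 h3
  rw [h3, Finset.sum_apply]
  simp_rw [h2]
  have hNz : 0 ≤ N * z := mul_nonneg hN'.le hz.1.le
  -- The only interval `[k/N, (k+1)/N)` containing `z` has this index.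
  rw [Finset.sum_eq_single ⌊N * z⌋₊]
  · rw [Set.indicator_of_mem]
    · refine integralIoo_apply le_rfl (by positivity) ?_ g
      rw [div_le_one hN']
      exact (Nat.floor_le hNz).trans (mul_le_of_le_one_right hN'.le hz.2.le)
    · rw [Set.mem_Ico, div_le_iff₀ hN', lt_div_iff₀ hN', mul_comm z]
      exact ⟨Nat.floor_le hNz, Nat.lt_floor_add_one _⟩
  · intro k _ hk
    rw [Set.indicator_of_notMem]
    rw [Set.mem_Ico, div_le_iff₀ hN', lt_div_iff₀ hN', mul_comm z]
    intro h
    exact hk ((Nat.floor_eq_iff hNz).2 h).symm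
  · intro h
    refine absurd (Finset.mem_range.2 ?_) h
    rw [Nat.floor_lt hNz]
    exact mul_lt_of_lt_one_right hN' hz.2

/-- A norm limit of finite-rank operators: the primitives at `z` and at `⌊N z⌋ / N` differ by an
integral over length at most `1/N`, so the error is at most `√(1/N)`. -/
theorem isCompactOperator_volterra : IsCompactOperator volterra := by
  refine isCompactOperator_of_tendsto (l := Filter.atTop) (F := volterraApprox) ?_
    (Filter.Eventually.of_forall fun N =>
      isCompactOperator_sum _ _ fun k _ => isCompactOperator_smulRight _ _)
  rw [tendsto_iff_norm_sub_tendsto_zero]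
  have hlim : Filter.Tendsto (fun N : ℕ => √(1 / (N : ℝ))) Filter.atTop (nhds 0) := by
    have := (Real.continuous_sqrt.tendsto 0).comp tendsto_one_div_atTop_nhds_zero_nat
    rwa [Real.sqrt_zero] at this
  refine squeeze_zero' (Filter.Eventually.of_forall fun _ => norm_nonneg _) ?_ hlim
  filter_upwards [Filter.eventually_gt_atTop 0] with N hN
  have hN' : (0 : ℝ) < N := Nat.cast_pos.2 hN
  refine ContinuousLinearMap.opNorm_le_bound _ (Real.sqrt_nonneg _) fun g => ?_
  refine Lp.norm_le_of_ae_le_unitVol (by positivity) ?_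
  rw [sub_apply]
  filter_upwards [ae_restrict_mem measurableSet_Ioo, volterra_coeFn g, volterraApprox_coeFn N g,
    Lp.coeFn_sub (volterraApprox N g) (volterra g)] with z hz h1 h2 h3
  have hNz : 0 ≤ N * z := mul_nonneg hN'.le hz.1.le
  have hle : (⌊N * z⌋₊ / N : ℝ) ≤ z := by
    rw [div_le_iff₀ hN', mul_comm z]
    exact Nat.floor_le hNz
  have hge : (0 : ℝ) ≤ ⌊N * z⌋₊ / N := by positivity
  have hi : Integrable g unitVol := (Lp.memLp g).integrable one_le_two
  rw [h3, Pi.sub_apply, h1, h2, norm_sub_rev, intervalIntegral.integral_interval_sub_left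
    (hi.intervalIntegrable_unitVol (by simp) ⟨hz.1.le, hz.2.le⟩)
    (hi.intervalIntegrable_unitVol (by simp) ⟨hge, hle.trans hz.2.le⟩)]
  refine (norm_intervalIntegral_le hge hle hz.2.le g).trans ?_
  gcongr
  rw [sub_le_iff_le_add, ← add_div, le_div_iff₀ hN', mul_comm z, add_comm]
  exact (Nat.lt_floor_add_one _).le
end

/-! ### The boundary value problem and its compact resolvent. -/

noncomputable section

theorem memLp_affine (q : ℝ) : MemLp (fun z : ℝ => (1 + q * z : ℂ)) 2 unitVol :=
  ContinuousOn.memLp_unitVol (by fun_prop) 2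

/-- The function with second derivative `x.2` and initial data `x.1`, `q * x.1`. -/
def doublePrimitive (q : ℝ) (x : ℂ × StateSpace) (z : ℝ) : ℂ :=
  x.1 * (1 + q * z) + ∫ t in (0 : ℝ)..z, volterra x.2 t

/-- `doublePrimitive` as an operator into `L₂(0,1)`. -/
def doublePrimitiveL (q : ℝ) : ℂ × StateSpace →L[ℂ] StateSpace :=
  (ContinuousLinearMap.fst ℂ ℂ StateSpace).smulRight (memLp_affine q).toLp
    + volterra ∘L volterra ∘L ContinuousLinearMap.snd ℂ ℂ StateSpace

theorem doublePrimitiveL_coeFn (q : ℝ) (x : ℂ × StateSpace) :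
    doublePrimitive q x =ᵐ[unitVol] doublePrimitiveL q x := by
  have e : doublePrimitiveL q x = x.1 • (memLp_affine q).toLp + volterra (volterra x.2) := rfl
  rw [e]
  filter_upwards [Lp.coeFn_add (x.1 • (memLp_affine q).toLp) (volterra (volterra x.2)),
    Lp.coeFn_smul x.1 (memLp_affine q).toLp, (memLp_affine q).coeFn_toLp,
    volterra_coeFn (volterra x.2)] with z h1 h2 h3 h4
  rw [h1, Pi.add_apply, h2, Pi.smul_apply, h3, h4]
  rfl

theorem isCompactOperator_doublePrimitiveL (q : ℝ) : IsCompactOperator (doublePrimitiveL q) :=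
  (isCompactOperator_smulRight _ _).add (isCompactOperator_volterra.comp_clm
    (volterra ∘L ContinuousLinearMap.snd ℂ ℂ StateSpace))

theorem isSobolevH2_doublePrimitive (q : ℝ) (x : ℂ × StateSpace) :
    IsSobolevH2 (doublePrimitive q x) (fun z => q * x.1 + ∫ t in (0 : ℝ)..z, x.2 t) x.2 := by
  have hi : Integrable x.2 unitVol := (Lp.memLp x.2).integrable one_le_two
  have hc := hi.continuousOn_primitive_unitVol
  refine ⟨(memLp_congr_ae (doublePrimitiveL_coeFn q x)).2 (Lp.memLp _),
    (continuousOn_const.add hc).memLp_unitVol 2, Lp.memLp _, fun z hz => ?_, fun z hz => by simp⟩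
  have hic : IntervalIntegrable (fun z => ∫ t in (0 : ℝ)..z, x.2 t) volume 0 z :=
    ((hc.memLp_unitVol 1).integrable le_rfl).intervalIntegrable_unitVol (by simp) hz
  have hv : ∫ t in (0 : ℝ)..z, volterra x.2 t = ∫ t in (0 : ℝ)..z, ∫ s in (0 : ℝ)..t, x.2 s := by
    rw [intervalIntegral.integral_of_le hz.1, intervalIntegral.integral_of_le hz.1,
      integral_Ioc_eq_integral_Ioo, integral_Ioc_eq_integral_Ioo]
    exact integral_congr_ae (ae_restrict_of_ae_restrict_of_subset
      (Set.Ioo_subset_Ioo_right hz.2) (volterra_coeFn x.2))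
  rw [intervalIntegral.integral_add intervalIntegrable_const hic, ← hv]
  simp only [doublePrimitive, intervalIntegral.integral_same, intervalIntegral.integral_const]
  simp
  ring

/-- The boundary functional `h'(1) - q₁ h(1)` in terms of the data of `doublePrimitive`. -/
def boundaryFunctional (q₀ q₁ : ℝ) : ℂ × StateSpace →L[ℂ] ℂ :=
  ((q₀ - q₁ * (1 + q₀) : ℂ)) • ContinuousLinearMap.fst ℂ ℂ StateSpace
    + (integralIoo 0 1 - (q₁ : ℂ) • integralIoo 0 1 ∘L volterra) ∘L
      ContinuousLinearMap.snd ℂ ℂ StateSpace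

theorem boundaryFunctional_apply (q₀ q₁ : ℝ) (x : ℂ × StateSpace) :
    boundaryFunctional q₀ q₁ x
      = (q₀ * x.1 + ∫ t in (0 : ℝ)..1, x.2 t) - q₁ * doublePrimitive q₀ x 1 := by
  have e := fun g => integralIoo_apply le_rfl zero_le_one le_rfl g
  simp only [boundaryFunctional, doublePrimitive, add_apply, sub_apply, smul_apply,
    ContinuousLinearMap.comp_apply, ContinuousLinearMap.coe_fst',
    ContinuousLinearMap.coe_snd', e, smul_eq_mul]
  push_cast
  ring

/-- Multiplication by a function that is continuous on `[0,1]`. -/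
def mulContinuousOn {m : ℝ → ℂ} (hm : ContinuousOn m (Set.Icc 0 1)) : StateSpace →L[ℂ] StateSpace :=
  (ContinuousLinearMap.mul ℂ ℂ).holderL unitVol ⊤ 2 2 (hm.memLp_unitVol ⊤).toLp

theorem mulContinuousOn_coeFn {m : ℝ → ℂ} (hm : ContinuousOn m (Set.Icc 0 1)) (g : StateSpace) :
    mulContinuousOn hm g =ᵐ[unitVol] fun z => m z * g z := by
  filter_upwards [(ContinuousLinearMap.mul ℂ ℂ).coeFn_holder (r := 2) (hm.memLp_unitVol ⊤).toLp g,
    (hm.memLp_unitVol ⊤).coeFn_toLp] with z h1 h2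
  rw [h2] at h1
  exact h1

/-- If `κ` is not an eigenvalue of the Sturm-Liouville operator, then the resolvent at `κ` exists
and is compact. -/
theorem exists_compact_resolvent {ρ : ℝ} (hρ : ρ ≠ 0) {a : ℝ → ℝ}
    (ha : ContinuousOn a (Set.Icc 0 1)) (q₀ q₁ : ℝ) {κ : ℂ}
    (hκ : ∀ h, ¬ IsEigenpair ρ a q₀ q₁ κ h) :
    ∃ T : StateSpace →L[ℂ] StateSpace, IsCompactOperator T ∧ ∀ f : StateSpace,
      ∃ h : ℝ → ℂ, h =ᵐ[unitVol] T f ∧ SLGraph ρ a q₀ q₁ h (fun z => f z + κ * h z) := by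
  have hρ' : (ρ : ℂ) ≠ 0 := Complex.ofReal_ne_zero.2 hρ
  have hm : ContinuousOn (fun z => (a z - κ) / (ρ : ℂ)) (Set.Icc 0 1) :=
    ((Complex.continuous_ofReal.comp_continuousOn ha).sub continuousOn_const).div_const _
  set Ψ := doublePrimitiveL q₀
  set M := mulContinuousOn hm
  -- The unknown is `x = (h 0, h'')`, with `h = Ψ x` already satisfying the condition at `0`. The
  -- first component of `x + K x` is the boundary defect at `1`, the second is `h'' + (a - κ) h /
  -- ρ`.
  let K : ℂ × StateSpace →L[ℂ] ℂ × StateSpace :=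
    (boundaryFunctional q₀ q₁ - ContinuousLinearMap.fst ℂ ℂ StateSpace).prod (M ∘L Ψ)
  have hK : IsCompactOperator K := by
    have e : K = (boundaryFunctional q₀ q₁ - ContinuousLinearMap.fst ℂ ℂ StateSpace).smulRight
        ((1, 0) : ℂ × StateSpace) + (ContinuousLinearMap.inr ℂ ℂ StateSpace ∘L M) ∘L Ψ := by
      ext x <;> simp [K]
    rw [e]
    exact (isCompactOperator_smulRight _ _).add
      ((isCompactOperator_doublePrimitiveL q₀).clm_comp (ContinuousLinearMap.inr ℂ ℂ StateSpace ∘L M))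
  have hsol : ∀ (x : ℂ × StateSpace) (f : StateSpace), boundaryFunctional q₀ q₁ x = 0 →
      x.2 + M (Ψ x) = (ρ : ℂ)⁻¹ • f →
      SLGraph ρ a q₀ q₁ (doublePrimitive q₀ x) (fun z => f z + κ * doublePrimitive q₀ x z) := by
    intro x f hb hx
    refine ⟨_, _, isSobolevH2_doublePrimitive q₀ x, ?_, ?_, ?_⟩
    · simp [doublePrimitive]
    · rw [boundaryFunctional_apply, sub_eq_zero] at hb
      exact hb
    · have hx' : x.2 = (ρ : ℂ)⁻¹ • f - M (Ψ x) := eq_sub_of_add_eq hx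
      filter_upwards [Lp.coeFn_sub ((ρ : ℂ)⁻¹ • f) (M (Ψ x)), Lp.coeFn_smul (ρ : ℂ)⁻¹ f,
        mulContinuousOn_coeFn hm (Ψ x), doublePrimitiveL_coeFn q₀ x] with z h1 h2 h3 h4
      rw [← hx', Pi.sub_apply, h2, h3, ← h4, Pi.smul_apply, smul_eq_mul] at h1
      rw [h1]
      field_simp
      ring
  -- A kernel element solves the homogeneous problem, so a nonzero `h` would be an eigenfunction for
  -- `κ`.
  have hinj : ∀ x, x + K x = 0 → x = 0 := by
    intro x hx
    have hx1 : boundaryFunctional q₀ q₁ x = 0 := by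
      have := congrArg Prod.fst hx
      simpa [K] using this
    have hx2 : x.2 + M (Ψ x) = 0 := congrArg Prod.snd hx
    have G := hsol x 0 hx1 (by rw [hx2, smul_zero])
    have G' : SLGraph ρ a q₀ q₁ (doublePrimitive q₀ x) (fun z => κ * doublePrimitive q₀ x z) := by
      refine G.congr_ae ?_
      filter_upwards [Lp.coeFn_zero ℂ 2 unitVol] with z hz
      rw [hz, Pi.zero_apply, zero_add]
    have h0 : ∀ᵐ z ∂unitVol, doublePrimitive q₀ x z = 0 := by
      by_contra h
      exact hκ _ ⟨G', h⟩
    have hc : x.1 = 0 := by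
      have := G.eqOn_zero h0 (by simp : (0 : ℝ) ∈ Set.Icc (0 : ℝ) 1)
      simpa [doublePrimitive] using this
    have hΨ : Ψ x = 0 := by
      refine Lp.ext ?_
      filter_upwards [h0, doublePrimitiveL_coeFn q₀ x, Lp.coeFn_zero ℂ 2 unitVol] with z h1 h2 h3
      rw [← h2, h1, h3, Pi.zero_apply]
    rw [hΨ, map_zero, add_zero] at hx2
    exact Prod.ext hc hx2
  obtain ⟨e, he⟩ := hK.exists_equiv_one_add hinj
  refine ⟨Ψ ∘L ((e.symm : ℂ × StateSpace →L[ℂ] ℂ × StateSpace) ∘L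
    ((ρ : ℂ)⁻¹ • ContinuousLinearMap.inr ℂ ℂ StateSpace)),
    (isCompactOperator_doublePrimitiveL q₀).comp_clm ((e.symm : ℂ × StateSpace →L[ℂ] ℂ × StateSpace)
      ∘L ((ρ : ℂ)⁻¹ • ContinuousLinearMap.inr ℂ ℂ StateSpace)), fun f => ?_⟩
  set x := e.symm ((ρ : ℂ)⁻¹ • ((0, f) : ℂ × StateSpace)) with hxdef
  refine ⟨doublePrimitive q₀ x, doublePrimitiveL_coeFn q₀ x, ?_⟩
  have hx : x + K x = (ρ : ℂ)⁻¹ • ((0, f) : ℂ × StateSpace) := by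
    rw [← he, hxdef, e.apply_symm_apply]
  refine hsol x f ?_ (congrArg Prod.snd hx)
  have := congrArg Prod.fst hx
  simpa [K] using this

end

/-! ### Spectral theory: orthonormality, completeness and divergence of the eigenvalues. -/

noncomputable section

/-- Absorbing the real shift into the potential lets Green's identity apply directly to `h` and the
right-hand side `f`. -/
theorem SLGraph.sub_shift {ρ : ℝ} {a : ℝ → ℝ} {q₀ q₁ : ℝ} {h f : ℝ → ℂ} {κ : ℝ}
    (H : SLGraph ρ a q₀ q₁ h fun z => f z + κ * h z) :
    SLGraph ρ (fun z => a z - κ) q₀ q₁ h f := by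
  obtain ⟨h₁, h₂, H, b0, b1, he⟩ := H
  refine ⟨h₁, h₂, H, b0, b1, ?_⟩
  filter_upwards [he] with z hz
  push_cast
  linear_combination hz

theorem isSymmetric_of_resolvent {ρ : ℝ} {a : ℝ → ℝ} (ha : ContinuousOn a (Set.Icc 0 1))
    {q₀ q₁ κ : ℝ} {T : StateSpace →L[ℂ] StateSpace}
    (hT : ∀ f : StateSpace, ∃ h : ℝ → ℂ, h =ᵐ[unitVol] T f ∧
      SLGraph ρ a q₀ q₁ h (fun z => f z + κ * h z)) : T.IsSymmetric := by
  intro f g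
  obtain ⟨h, hf, H⟩ := hT f
  obtain ⟨k, hg, K⟩ := hT g
  -- The bilinear symmetry becomes sesquilinear by conjugating one argument, which is allowed
  -- because all data are real.
  have := (H.sub_shift.star).integral_mul_comm (ha.sub continuousOn_const) K.sub_shift
  rw [L2.inner_def, L2.inner_def]
  refine Eq.trans ?_ (this.symm.trans ?_)
  · refine integral_congr_ae ?_
    filter_upwards [hf] with z hz
    rw [ContinuousLinearMap.coe_coe, ← hz, RCLike.inner_apply, mul_comm]
    rfl
  · refine integral_congr_ae ?_
    filter_upwards [hg] with z hz
    rw [ContinuousLinearMap.coe_coe, ← hz, RCLike.inner_apply, mul_comm]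
    rfl

theorem isSobolevH2_of_hasDerivAt {h h₁ h₂ : ℝ → ℂ} (hd : ∀ z, HasDerivAt h (h₁ z) z)
    (hd₁ : ∀ z, HasDerivAt h₁ (h₂ z) z) (hc : Continuous h₂) : IsSobolevH2 h h₁ h₂ := by
  have c0 : Continuous h := continuous_iff_continuousAt.2 fun z => (hd z).continuousAt
  have c1 : Continuous h₁ := continuous_iff_continuousAt.2 fun z => (hd₁ z).continuousAt
  refine ⟨c0.continuousOn.memLp_unitVol 2, c1.continuousOn.memLp_unitVol 2,
    hc.continuousOn.memLp_unitVol 2, fun z _ => ?_, fun z _ => ?_⟩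
  · rw [intervalIntegral.integral_eq_sub_of_hasDerivAt (fun x _ => hd x)
      (c1.intervalIntegrable _ _)]
    ring
  · rw [intervalIntegral.integral_eq_sub_of_hasDerivAt (fun x _ => hd₁ x)
      (hc.intervalIntegrable _ _)]
    ring

/-- There is a function in `H²(0,1)` with vanishing boundary values and prescribed boundary
derivatives. -/
theorem exists_isSobolevH2_boundary_deriv (α β : ℂ) : ∃ h h₁ h₂ : ℝ → ℂ, IsSobolevH2 h h₁ h₂ ∧
    h 0 = 0 ∧ h 1 = 0 ∧ h₁ 0 = α ∧ h₁ 1 = β := by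
  have hpow : ∀ (n : ℕ) (z : ℝ), HasDerivAt (fun z : ℝ => (z : ℂ) ^ n) (n * (z : ℂ) ^ (n - 1)) z :=
    fun n z => (hasDerivAt_pow n (z : ℂ)).comp_ofReal
  -- Cubic Hermite polynomials for the two endpoint slopes.
  refine ⟨fun z => α * (z ^ 1 - 2 * z ^ 2 + z ^ 3) + β * (z ^ 3 - z ^ 2),
    fun z => α * (1 - 4 * z ^ 1 + 3 * z ^ 2) + β * (3 * z ^ 2 - 2 * z ^ 1),
    fun z => α * (6 * z - 4) + β * (6 * z - 2), isSobolevH2_of_hasDerivAt ?_ ?_ (by fun_prop),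
    by simp, by norm_num, by simp, by norm_num⟩
  · intro z
    convert! ((((hpow 1 z).sub ((hpow 2 z).const_mul 2)).add (hpow 3 z)).const_mul α).add
      (((hpow 3 z).sub (hpow 2 z)).const_mul β) using 1
    push_cast
    simp only [pow_zero, pow_one]
    ring
  · intro z
    convert! ((((hasDerivAt_const z (1 : ℂ)).sub ((hpow 1 z).const_mul 4)).add
      ((hpow 2 z).const_mul 3)).const_mul α).add
      ((((hpow 2 z).const_mul 3).sub ((hpow 1 z).const_mul 2)).const_mul β) using 1
    push_cast
    simp only [pow_zero, pow_one]
    ring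

/-- A compact operator maps an orthonormal sequence of eigenvectors to a null sequence. -/
theorem IsCompactOperator.not_tendsto_eigenvalues {H : Type*} [NormedAddCommGroup H]
    [InnerProductSpace ℂ H] {T : H →L[ℂ] H} (hT : IsCompactOperator T) {e : ℕ → H}
    (he : Orthonormal ℂ e) {ν : ℕ → ℂ} (hν : ∀ i, T (e i) = ν i • e i) {l : ℂ} (hl : l ≠ 0) :
    ¬ Filter.Tendsto ν Filter.atTop (nhds l) := by
  intro hlim
  obtain ⟨S, hS, hsub⟩ := IsCompactOperator.image_closedBall_subset_compact (f := T.toLinearMap)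
    hT 1
  have hmem : ∀ i, T (e i) ∈ S := fun i =>
    hsub ⟨e i, by simp [he.1 i], rfl⟩
  obtain ⟨x, -, ψ, hψ, hx⟩ := hS.tendsto_subseq hmem
  have h1 : Filter.Tendsto (fun i => (ν (ψ i))⁻¹ • T (e (ψ i))) Filter.atTop (nhds (l⁻¹ • x)) :=
    ((hlim.comp hψ.tendsto_atTop).inv₀ hl).smul hx
  have h2 : Filter.Tendsto (fun i => e (ψ i)) Filter.atTop (nhds (l⁻¹ • x)) := by
    refine h1.congr' ?_
    filter_upwards [(hlim.comp hψ.tendsto_atTop).eventually_ne hl] with i hi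
    rw [hν, smul_smul, inv_mul_cancel₀ (by exact hi), one_smul]
  have h3 := ((h2.comp (Filter.tendsto_add_atTop_nat 1)).sub h2).norm.pow 2
  rw [sub_self, norm_zero] at h3
  -- A convergent subsequence of the images, divided by the eigenvalues, would give a convergent
  -- subsequence of `e`, but orthonormal vectors stay at distance `√2`.
  have h4 : ∀ i, ‖e (ψ (i + 1)) - e (ψ i)‖ ^ 2 = 2 := by
    intro i
    have hne : ψ (i + 1) ≠ ψ i := (hψ (Nat.lt_succ_self i)).ne'
    rw [@norm_sub_sq ℂ, he.2 hne, he.1, he.1]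
    norm_num
  have h5 := tendsto_nhds_unique (h3.congr h4) tendsto_const_nhds
  norm_num at h5

namespace IsEigensystem

variable {ρ : ℝ} {a : ℝ → ℝ} {q₀ q₁ : ℝ} {lam : ℕ → ℝ} {φ : ℕ → ℝ → ℝ}
  (hs : IsEigensystem ρ a q₀ q₁ lam φ)

include hs

theorem vec_coeFn (i : ℕ) : hs.vec i =ᵐ[unitVol] fun z => (φ i z : ℂ) :=
  (hs.memLp i).coeFn_toLp

theorem inner_vec_left (i : ℕ) {h : ℝ → ℂ} {f : StateSpace} (hf : f =ᵐ[unitVol] h) :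
    inner ℂ (hs.vec i) f = ∫ z, h z * φ i z ∂unitVol := by
  rw [L2.inner_def]
  refine integral_congr_ae ?_
  filter_upwards [hs.vec_coeFn i, hf] with z h1 h2
  rw [h1, h2, RCLike.inner_apply]
  simp

theorem orthonormal_vec (ha : ContinuousOn a (Set.Icc 0 1)) : Orthonormal ℂ hs.vec := by
  rw [orthonormal_iff_ite]
  intro i j
  rw [hs.inner_vec_left i (hs.vec_coeFn j)]
  split_ifs with hij
  · subst hij
    rw [integral_unitVol_eq_intervalIntegral]
    have := congrArg (fun x : ℝ => (x : ℂ)) (hs.normalized i)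
    simp only [← intervalIntegral.integral_ofReal] at this
    simpa [pow_two] using this
  · have e := (hs.eigen j).1.integral_mul_comm ha (hs.eigen i).1
    have e1 : ∫ z, (lam j : ℂ) * φ j z * φ i z ∂unitVol
        = lam j * ∫ z, (φ j z : ℂ) * φ i z ∂unitVol := by
      rw [← integral_const_mul]; simp only [mul_assoc]
    have e2 : ∫ z, (φ j z : ℂ) * (lam i * φ i z) ∂unitVol
        = lam i * ∫ z, (φ j z : ℂ) * φ i z ∂unitVol := by
      rw [← integral_const_mul]; simp only [mul_left_comm]
    rw [e1, e2, ← sub_eq_zero, ← sub_mul, mul_eq_zero, sub_eq_zero, Complex.ofReal_inj] at e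
    exact e.resolve_left fun h => hij (hs.strictAnti.injective h).symm

theorem not_isEigenpair_add_one (h : ℝ → ℂ) :
    ¬ IsEigenpair ρ a q₀ q₁ ((lam 0 + 1 : ℝ) : ℂ) h := by
  intro H
  obtain ⟨i, hi⟩ := hs.exhaustive _ ⟨h, H⟩
  have := hs.strictAnti.antitone (Nat.zero_le i)
  linarith

/-- `T φ_i` and `(λ_i - κ)⁻¹ φ_i` solve the same boundary value problem, and a nonzero difference
would be an eigenfunction for `κ`. -/
theorem resolvent_vec {κ : ℝ} (hκ : ∀ h, ¬ IsEigenpair ρ a q₀ q₁ (κ : ℂ) h) {i : ℕ}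
    (hi : lam i ≠ κ) {T : StateSpace →L[ℂ] StateSpace}
    (hT : ∀ f : StateSpace, ∃ h : ℝ → ℂ, h =ᵐ[unitVol] T f ∧
      SLGraph ρ a q₀ q₁ h (fun z => f z + κ * h z)) :
    T (hs.vec i) = ((lam i - κ : ℂ))⁻¹ • hs.vec i := by
  obtain ⟨h, hh, H⟩ := hT (hs.vec i)
  have hne : (lam i - κ : ℂ) ≠ 0 := by
    rw [sub_ne_zero]; exact_mod_cast hi
  have W := H.add ((hs.eigen i).1.const_smul (-(lam i - κ : ℂ)⁻¹))
  have W' := W.congr_ae (k := fun z => κ *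
      (h + (-(lam i - κ : ℂ)⁻¹) • fun z => (φ i z : ℂ)) z) (by
    filter_upwards [hs.vec_coeFn i] with z hz
    simp only [Pi.add_apply, Pi.smul_apply, smul_eq_mul, hz]
    field_simp
    ring)
  have h0 : ∀ᵐ z ∂unitVol, (h + (-(lam i - κ : ℂ)⁻¹) • fun z => (φ i z : ℂ)) z = 0 := by
    by_contra hc
    exact hκ _ ⟨W', hc⟩
  refine Lp.ext ?_
  filter_upwards [h0, hh, hs.vec_coeFn i, Lp.coeFn_smul ((lam i - κ : ℂ))⁻¹ (hs.vec i)]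
    with z h1 h2 h3 h4
  rw [h4, Pi.smul_apply, h3, ← h2]
  simp only [Pi.add_apply, Pi.smul_apply, smul_eq_mul] at h1 ⊢
  linear_combination h1

/-- The eigenvectors of the Sturm-Liouville operator are complete. -/
theorem span_vec_orthogonal (hρ : ρ ≠ 0) (ha : ContinuousOn a (Set.Icc 0 1)) :
    (Submodule.span ℂ (Set.range hs.vec))ᗮ = ⊥ := by
  obtain ⟨T, hTc, hT⟩ := exists_compact_resolvent hρ ha q₀ q₁ hs.not_isEigenpair_add_one
  have hsym := isSymmetric_of_resolvent ha hT
  rw [eq_bot_iff, ← ContinuousLinearMap.orthogonalComplement_iSup_eigenspaces_eq_bot hTc hsym]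
  -- By the spectral theorem it suffices that each eigenspace of `T` lies in the span of the `φ_i`.
  refine Submodule.orthogonal_le (iSup_le fun μ => ?_)
  intro f hf
  rw [Module.End.mem_eigenspace_iff, ContinuousLinearMap.coe_coe] at hf
  obtain ⟨h, hh, H⟩ := hT f
  rcases eq_or_ne f 0 with rfl | hf0
  · exact zero_mem _
  have hμ : μ ≠ 0 := by
    rintro rfl
    have h0 : ∀ᵐ z ∂unitVol, h z = 0 := by
      filter_upwards [hh, Lp.coeFn_zero ℂ 2 unitVol] with z h1 h2
      rw [h1, hf, zero_smul, h2, Pi.zero_apply]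
    refine hf0 (Lp.ext ?_)
    filter_upwards [H.ae_eq_zero h0, h0, Lp.coeFn_zero ℂ 2 unitVol] with z h1 h2 h3
    rwa [h2, mul_zero, add_zero, ← Pi.zero_apply (M := fun _ => ℂ) z, ← h3] at h1
  have hhf : ∀ᵐ z ∂unitVol, h z = μ * f z := by
    filter_upwards [hh, Lp.coeFn_smul μ f] with z h1 h2
    rw [h1, hf, h2, Pi.smul_apply, smul_eq_mul]
  have hconj : starRingEnd ℂ μ = μ := by
    refine hsym.conj_eigenvalue_eq_self ?_
    exact Module.End.hasEigenvalue_of_hasEigenvector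
      ⟨Module.End.mem_eigenspace_iff.2 hf, hf0⟩
  obtain ⟨r, rfl⟩ := Complex.conj_eq_iff_real.1 hconj
  -- `T f = r f` means that `h = r f` is an eigenfunction of the differential operator for `κ +
  -- r⁻¹`, with `κ = lam 0 + 1`.
  have H' : SLGraph ρ a q₀ q₁ h (fun z => ((lam 0 + 1 + r⁻¹ : ℝ) : ℂ) * h z) := by
    refine H.congr_ae ?_
    filter_upwards [hhf] with z hz
    rw [hz]
    push_cast
    field_simp
    ring
  have hnz : ¬ ∀ᵐ z ∂unitVol, h z = 0 := by
    intro h0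
    refine hf0 (Lp.ext ?_)
    filter_upwards [h0, hhf, Lp.coeFn_zero ℂ 2 unitVol] with z h1 h2 h3
    rw [h3, Pi.zero_apply]
    rw [h1] at h2
    exact (mul_eq_zero.1 h2.symm).resolve_left hμ
  obtain ⟨i, hi⟩ := hs.exhaustive _ ⟨h, H', hnz⟩
  rw [← hi] at H'
  have e := H'.eqOn_smul_of_eigen hρ ha (hs.eigen i).1 (hs.eigen i).2
  have hfe : f = ((r : ℂ)⁻¹ * (h 0 / φ i 0)) • hs.vec i := by
    refine Lp.ext ?_
    filter_upwards [ae_restrict_mem measurableSet_Ioo, hhf, hs.vec_coeFn i,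
      Lp.coeFn_smul ((r : ℂ)⁻¹ * (h 0 / φ i 0)) (hs.vec i)] with z hz h1 h2 h3
    rw [h3, Pi.smul_apply, h2]
    have := e (Set.Ioo_subset_Icc_self hz)
    rw [h1] at this
    simp only [Pi.smul_apply, smul_eq_mul] at this ⊢
    rw [mul_assoc, ← this, inv_mul_cancel_left₀ hμ]
  rw [hfe]
  exact Submodule.smul_mem _ _ (Submodule.subset_span ⟨i, rfl⟩)

/-- A decreasing sequence otherwise converges to some `l < κ`; the resolvent eigenvalues would then
tend to `(l - κ)⁻¹ ≠ 0`, against compactness. -/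
theorem tendsto_lam_atBot (hρ : ρ ≠ 0) (ha : ContinuousOn a (Set.Icc 0 1)) :
    Filter.Tendsto lam Filter.atTop Filter.atBot := by
  obtain ⟨T, hTc, hT⟩ := exists_compact_resolvent hρ ha q₀ q₁ hs.not_isEigenpair_add_one
  refine (tendsto_atTop_of_antitone hs.strictAnti.antitone).resolve_right ?_
  rintro ⟨l, hl⟩
  have hl0 : l ≤ lam 0 :=
    le_of_tendsto hl (Filter.Eventually.of_forall fun i => hs.strictAnti.antitone (Nat.zero_le i))
  have hne : (l - (lam 0 + 1 : ℝ) : ℂ) ≠ 0 := by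
    rw [sub_ne_zero, Ne, Complex.ofReal_inj]
    linarith
  refine hTc.not_tendsto_eigenvalues (hs.orthonormal_vec ha)
    (fun i => hs.resolvent_vec hs.not_isEigenpair_add_one (i := i) ?_ hT) (inv_ne_zero hne)
    ((((Complex.continuous_ofReal.tendsto l).comp hl).sub_const _).inv₀ hne)
  have := hs.strictAnti.antitone (Nat.zero_le i)
  linarith

/-! ### Square-summability of the modal input coefficients. -/

/-- Take `G` with zero boundary values and boundary slopes `α`, and `F = ρ G'' + a G`. Green's
identity against `φ_i` leaves exactly the boundary term `b_i · α`. -/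
theorem exists_inner_eq_inputVec_dotProduct (ha : ContinuousOn a (Set.Icc 0 1)) (α : Fin 2 → ℂ) :
    ∃ F G : StateSpace, ∀ i, inputVec ρ φ i ⬝ᵥ α
      = inner ℂ (hs.vec i) F - lam i * inner ℂ (hs.vec i) G := by
  obtain ⟨h, h₁, h₂, H, h0, h1, h10, h11⟩ := exists_isSobolevH2_boundary_deriv (α 0) (α 1)
  have hac : ContinuousOn (fun z => (a z : ℂ)) (Set.Icc 0 1) :=
    Complex.continuous_ofReal.comp_continuousOn ha
  have hF : MemLp (fun z => ρ * h₂ z + a z * h z) 2 unitVol :=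
    (H.memLp_two.const_mul _).add ((hac.mul H.continuousOn).memLp_unitVol 2)
  refine ⟨hF.toLp, H.memLp.toLp, fun i => ?_⟩
  rw [hs.inner_vec_left i hF.coeFn_toLp, hs.inner_vec_left i H.memLp.coeFn_toLp]
  have := SLGraph.green ha H (hs.eigen i).1
  rw [h0, h1, h10, h11] at this
  simp_rw [mul_left_comm (h _)] at this
  rw [integral_const_mul] at this
  rw [this]
  simp [inputVec, dotProduct, Fin.sum_univ_two]
  ring

theorem summable_inputVec_div (hρ : ρ ≠ 0) (ha : ContinuousOn a (Set.Icc 0 1)) (α : Fin 2 → ℂ)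
    (μ : ℂ) : Summable fun i => ‖(inputVec ρ φ i ⬝ᵥ α) / (μ - lam i)‖ ^ 2 := by
  obtain ⟨F, G, hFG⟩ := hs.exists_inner_eq_inputVec_dotProduct ha α
  have ho := hs.orthonormal_vec ha
  have hsum : Summable fun i =>
      2 * (‖inner ℂ (hs.vec i) (F - μ • G)‖ ^ 2 + ‖inner ℂ (hs.vec i) G‖ ^ 2) :=
    ((ho.inner_products_summable (F - μ • G)).add (ho.inner_products_summable G)).mul_left 2
  have hlarge : ∀ᶠ i in Filter.atTop, lam i ≤ μ.re - 1 :=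
    (hs.tendsto_lam_atBot hρ ha).eventually_le_atBot _
  refine hsum.of_norm_bounded_eventually_nat ?_
  filter_upwards [hlarge] with i hi
  have hge : 1 ≤ ‖μ - lam i‖ := by
    refine le_trans ?_ (Complex.re_le_norm _)
    rw [Complex.sub_re, Complex.ofReal_re]
    linarith
  have hne : μ - lam i ≠ 0 := norm_pos_iff.1 (zero_lt_one.trans_le hge)
  -- Writing `F - λ_i G = (F - μ G) + (μ - λ_i) G` cancels the unbounded factor.
  have e : (inputVec ρ φ i ⬝ᵥ α) / (μ - lam i)
      = inner ℂ (hs.vec i) (F - μ • G) / (μ - lam i) + inner ℂ (hs.vec i) G := by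
    rw [hFG, inner_sub_right, inner_smul_right]
    field_simp
    ring
  rw [Real.norm_of_nonneg (by positivity), e]
  have h1 : ‖inner ℂ (hs.vec i) (F - μ • G) / (μ - lam i)‖ ≤ ‖inner ℂ (hs.vec i) (F - μ • G)‖ := by
    rw [norm_div]
    exact div_le_self (norm_nonneg _) hge
  calc _ ≤ (‖inner ℂ (hs.vec i) (F - μ • G)‖ + ‖inner ℂ (hs.vec i) G‖) ^ 2 := by
        gcongr
        exact (norm_add_le _ _).trans (by gcongr)
    _ ≤ _ := add_sq_le

end IsEigensystem
end

/-! ### Riesz bases from finite-rank perturbations of the identity. -/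

noncomputable section

theorem isRieszBasis_of_equiv {H : Type*} [NormedAddCommGroup H] [InnerProductSpace ℂ H]
    {e : ℕ → H} (he : Orthonormal ℂ e)
    (hd : (Submodule.span ℂ (Set.range e)).topologicalClosure = ⊤) (R : H ≃L[ℂ] H) :
    IsRieszBasis fun i => R (e i) := by
  constructor
  · rw [← Submodule.dense_iff_topologicalClosure_eq_top] at hd ⊢
    have := R.surjective.denseRange.dense_image R.continuous hd
    have h2 : Submodule.span ℂ (Set.range fun i => R (e i))
        = (Submodule.span ℂ (Set.range e)).map R.toLinearMap := by
      rw [Submodule.map_span, ← Set.range_comp]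
      rfl
    rw [h2]
    exact this
  · have hsum : ∀ (s : Finset ℕ) (α : ℕ → ℂ), ‖∑ i ∈ s, α i • e i‖ ^ 2 = ∑ i ∈ s, ‖α i‖ ^ 2 := by
      intro s α
      have := he.inner_sum α α s
      rw [inner_self_eq_norm_sq_to_K] at this
      simp_rw [RCLike.conj_mul] at this
      exact_mod_cast this
    -- Adding `1` keeps the constants positive without bounding the operator norms below.
    set A := ‖(R : H →L[ℂ] H)‖ + 1
    set B := ‖(R.symm : H →L[ℂ] H)‖ + 1
    have hA : 0 < A := by positivity
    have hB : 0 < B := by positivity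
    refine ⟨(B ^ 2)⁻¹, A ^ 2, by positivity, by positivity, fun s α => ?_⟩
    rw [← hsum s α]
    have hR : ∑ i ∈ s, α i • R (e i) = R (∑ i ∈ s, α i • e i) := by simp
    rw [hR]
    set x := ∑ i ∈ s, α i • e i
    constructor
    · rw [inv_mul_le_iff₀ (by positivity), ← mul_pow]
      gcongr
      calc ‖x‖ = ‖(R.symm : H →L[ℂ] H) (R x)‖ := by simp
        _ ≤ ‖(R.symm : H →L[ℂ] H)‖ * ‖R x‖ := ContinuousLinearMap.le_opNorm _ _
        _ ≤ B * ‖R x‖ := by gcongr; simp [B]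
    · rw [← mul_pow]
      gcongr
      calc ‖R x‖ = ‖(R : H →L[ℂ] H) x‖ := rfl
        _ ≤ ‖(R : H →L[ℂ] H)‖ * ‖x‖ := ContinuousLinearMap.le_opNorm _ _
        _ ≤ A * ‖x‖ := by gcongr; simp [A]

/-- Replacing the first `n` vectors of an orthonormal basis by an invertible combination of them,
and adding to the others combinations of the first `n` with square-summable coefficients, yields a
Riesz basis. -/
theorem isRieszBasis_of_blockTriangular {H : Type*} [NormedAddCommGroup H] [InnerProductSpace ℂ H]
    [CompleteSpace H] {e : ℕ → H} (he : Orthonormal ℂ e)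
    (hd : (Submodule.span ℂ (Set.range e))ᗮ = ⊥) {n : ℕ} (C : ℕ → Fin n → ℂ)
    (hC : ∀ j, Summable fun i => ‖C i j‖ ^ 2)
    (hinv : ∀ y : Fin n → ℂ, (∀ j, ∑ i : Fin n, y i * C i j = 0) → y = 0) :
    IsRieszBasis fun i => (∑ j : Fin n, C i j • e j) + (if i < n then 0 else e i) := by
  let b := HilbertBasis.mkOfOrthogonalEqBot he hd
  have hb : ∀ i, b i = e i := fun i => by simp [b]
  have hmem : ∀ j, Memℓp (fun i => star (C i j)) 2 := fun j =>
    memℓp_gen (by simpa using hC j)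
  -- Square-summability of column `j` makes it the sequence of values of the bounded functional `⟨d
  -- j, ·⟩` on the basis.
  let d : Fin n → H := fun j => b.repr.symm ⟨_, hmem j⟩
  have hde : ∀ i j, inner ℂ (d j) (e i) = C i j := by
    intro i j
    rw [← inner_conj_symm, ← hb, ← HilbertBasis.repr_apply_apply]
    simp [d]
  -- The term with `d j` adds the combination of the first `n` vectors; the one with `-e j` removes
  -- `e i` itself when `i < n`.
  let K : H →L[ℂ] H := ∑ j : Fin n, (innerSL ℂ (d j - e j)).smulRight (e j)
  have hK : IsCompactOperator K := isCompactOperator_sum _ _ fun j _ => isCompactOperator_smulRight _ _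
  have hKx : ∀ x, K x = ∑ j : Fin n, (inner ℂ (d j - e j) x) • e j := by
    intro x; simp [K]
  have hRe : ∀ i, e i + K (e i) = (∑ j : Fin n, C i j • e j) + (if i < n then 0 else e i) := by
    intro i
    rw [hKx]
    simp_rw [inner_sub_left, hde, orthonormal_iff_ite.1 he, sub_smul, Finset.sum_sub_distrib]
    have : ∑ j : Fin n, (if (j : ℕ) = i then (1 : ℂ) else 0) • e j = if i < n then e i else 0 := by
      split_ifs with hi
      · rw [Finset.sum_eq_single ⟨i, hi⟩]
        · simp
        · intro j _ hj
          rw [if_neg (fun h => hj (Fin.ext h)), zero_smul]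
        · simp
      · refine Finset.sum_eq_zero fun j _ => ?_
        rw [if_neg fun h : (j : ℕ) = i => hi (h ▸ j.2), zero_smul]
    rw [this]
    split_ifs <;> abel
  have hinj : ∀ x, x + K x = 0 → x = 0 := by
    intro x hx
    set y : Fin n → ℂ := fun j => -inner ℂ (d j - e j) x
    -- `x = -K x` forces a kernel vector into the span of the first `n` basis vectors, where only
    -- the finite matrix `C` matters.
    have hxy : x = ∑ j : Fin n, y j • e j := by
      rw [eq_neg_of_add_eq_zero_left hx, hKx, ← Finset.sum_neg_distrib]
      simp only [y, neg_smul]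
    have h0 : ∑ j : Fin n, (∑ i : Fin n, y i * C i j) • e j = 0 := by
      have : x + K x = ∑ i : Fin n, y i • (e i + K (e i)) := by
        conv_lhs => rw [hxy]
        simp [Finset.sum_add_distrib]
      rw [hx] at this
      rw [this]
      simp_rw [hRe, Fin.is_lt, if_true, add_zero, Finset.smul_sum, smul_smul, Finset.sum_smul]
      rw [Finset.sum_comm]
    have hli : LinearIndependent ℂ fun j : Fin n => e j :=
      he.linearIndependent.comp _ Fin.val_injective
    have hy := hinv y (Fintype.linearIndependent_iff.1 hli _ h0)
    rw [hxy, hy]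
    simp
  obtain ⟨R, hR⟩ := hK.exists_equiv_one_add hinj
  have := isRieszBasis_of_equiv he (Submodule.topologicalClosure_eq_top_iff.2 hd) R
  simp_rw [hR, hRe] at this
  exact this

/-! ### Application to the closed-loop vectors. -/

/-- The columns of `V` are eigenvectors of `Lam - B * K` for distinct eigenvalues, hence
independent. -/
theorem IsAssignedBy.isUnit_det {n : ℕ} {Lam : Matrix (Fin n) (Fin n) ℂ}
    {B : Matrix (Fin n) (Fin 2) ℂ} {K : Matrix (Fin 2) (Fin n) ℂ} {lamt : Fin n → ℂ}
    {P : Matrix (Fin 2) (Fin n) ℂ} {V : Matrix (Fin n) (Fin n) ℂ}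
    (hK : IsAssignedBy Lam B K lamt P V) (hinj : Function.Injective lamt) : IsUnit V.det := by
  have hli : LinearIndependent ℂ V.col := by
    refine Module.End.eigenvectors_linearIndependent' (Matrix.toLin' (Lam - B * K)) lamt hinj V.col
      fun i => ⟨Module.End.mem_eigenspace_iff.2 ?_, hK.ne_zero i⟩
    have h1 := hK.modal i
    rw [Matrix.sub_mulVec, Matrix.smul_mulVec, Matrix.one_mulVec, hK.gain i] at h1
    rw [Matrix.toLin'_apply, Matrix.sub_mulVec, ← Matrix.mulVec_mulVec, ← h1]
    simp
  rw [← Matrix.isUnit_iff_isUnit_det]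
  exact Matrix.linearIndependent_cols_iff_isUnit.1 hli

theorem coeffRow_of_le {ρ : ℝ} {lam : ℕ → ℝ} {φ : ℕ → ℝ → ℝ} {n : ℕ} {lamt : Fin n → ℂ}
    (P : Matrix (Fin 2) (Fin n) ℂ) (V : Matrix (Fin n) (Fin n) ℂ) {i : ℕ} (hi : n ≤ i)
    (hlam : ∀ k, lamt k ≠ lam i) (j : Fin n) :
    coeffRow ρ lam φ lamt P V i j
      = ∑ k, (inputVec ρ φ i ⬝ᵥ P.col k) / (lamt k - lam i) * V⁻¹ k j := by
  have hdiag : (Matrix.diagonal lamt - (lam i : ℂ) • (1 : Matrix (Fin n) (Fin n) ℂ))⁻¹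
      = Matrix.diagonal fun k => (lamt k - lam i)⁻¹ := by
    refine Matrix.inv_eq_right_inv ?_
    rw [Matrix.smul_one_eq_diagonal, Matrix.diagonal_sub, Matrix.diagonal_mul_diagonal,
      ← Matrix.diagonal_one]
    congr 1
    ext k
    exact mul_inv_cancel₀ (sub_ne_zero.2 (hlam k))
  rw [coeffRow, dif_neg (not_lt.2 hi), hdiag, ← Matrix.vecMul_vecMul, ← Matrix.vecMul_vecMul]
  simp only [Matrix.vecMul, dotProduct]
  refine Finset.sum_congr rfl fun k _ => ?_
  simp [Matrix.diagonal_apply, div_eq_mul_inv]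

end

/-- Each entry with `i ≥ n` is a fixed combination of `n` square-summable sequences; the factor `n`
is Cauchy-Schwarz. The finitely many earlier entries are irrelevant. -/
theorem IsEigensystem.summable_coeffRow {ρ : ℝ} (hρ : ρ ≠ 0) {a : ℝ → ℝ}
    (ha : ContinuousOn a (Set.Icc 0 1)) {q₀ q₁ : ℝ} {lam : ℕ → ℝ} {φ : ℕ → ℝ → ℝ}
    (hs : IsEigensystem ρ a q₀ q₁ lam φ) {n : ℕ} {lamt : Fin n → ℂ}
    (P : Matrix (Fin 2) (Fin n) ℂ) (V : Matrix (Fin n) (Fin n) ℂ)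
    (hspec : ∀ i, lamt i ∉ spectrumTail lam n) (j : Fin n) :
    Summable fun i => ‖coeffRow ρ lam φ lamt P V i j‖ ^ 2 := by
  have hsum : Summable fun i => (n : ℝ) *
      ∑ k, ‖(inputVec ρ φ i ⬝ᵥ P.col k) / (lamt k - lam i)‖ ^ 2 * ‖V⁻¹ k j‖ ^ 2 :=
    (summable_sum fun k _ =>
      (hs.summable_inputVec_div hρ ha (P.col k) (lamt k)).mul_right _).mul_left _
  refine hsum.of_norm_bounded_eventually_nat ?_
  filter_upwards [Filter.eventually_ge_atTop n] with i hi
  rw [Real.norm_of_nonneg (by positivity),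
    coeffRow_of_le P V hi (fun k h => hspec k ⟨i, hi, h⟩) j]
  refine (pow_le_pow_left₀ (norm_nonneg _) (norm_sum_le _ _) 2).trans ?_
  refine sq_sum_le_card_mul_sum_sq.trans_eq ?_
  simp [mul_pow]

theorem lemma1 (ρ : ℝ) (hρ : 0 < ρ) (a : ℝ → ℝ) (ha : ContinuousOn a (Set.Icc 0 1)) (q₀ q₁ : ℝ)
    (lam : ℕ → ℝ) (φ : ℕ → ℝ → ℝ) (hs : IsEigensystem ρ a q₀ q₁ lam φ)
    (n : ℕ) (K : Matrix (Fin 2) (Fin n) ℂ) (lamt : Fin n → ℂ)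
    (P : Matrix (Fin 2) (Fin n) ℂ) (V : Matrix (Fin n) (Fin n) ℂ)
    (hK : IsAssignedBy (lamMatrix lam n) (inputMatrix ρ φ n) K lamt P V)
    (hdistinct : Function.Injective lamt)
    (hspec : ∀ i, lamt i ∉ spectrumTail lam n) :
    IsRieszBasis (closedLoopVec hs lamt P V) := by
  refine isRieszBasis_of_blockTriangular (hs.orthonormal_vec ha)
    (hs.span_vec_orthogonal hρ.ne' ha) (fun i j => star (coeffRow ρ lam φ lamt P V i j)) ?_ ?_
  · intro j
    simpa using hs.summable_coeffRow hρ.ne' ha P V hspec j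
  · intro y hy
    -- The first `n` coefficient rows form `V⁻¹`, but enter conjugated, so the relation is
    -- conjugated first.
    have h0 : Matrix.vecMul (star y) V⁻¹ = 0 := by
      ext j
      have := congrArg star (hy j)
      simpa [coeffRow, Matrix.vecMul, dotProduct, mul_comm] using this
    have h1 := congrArg (Matrix.vecMul · V) h0
    simp only [Matrix.vecMul_vecMul, Matrix.nonsing_inv_mul V (hK.isUnit_det hdistinct),
      Matrix.vecMul_one, Matrix.zero_vecMul] at h1
    exact star_eq_zero.1 h1
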